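/- Let $k$ be an algebraically closed field of characteristic $p>2$, and let $\mathcal C$ be a symmetric fusion category over $k$: a $k$-linear semisimple abelian rigid symmetric monoidal category with $k$-bilinear tensor product, finite-dimensional $\mathrm{Hom}$-spaces, finitely many isomorphism classes of simple objects, and simple unit object $\mathbf 1$. Traces and dimensions in rigid symmetric categories are those of the canonical spherical structure given by the symmetry, and a morphism $f:X\to Y$ is negligible if $fu$ has trace $0$ for every $u:Y\to X$. Let $C_p$ be the cyclic group of order $p$ with generator $\sigma$, let $L_s=k[\sigma]/(\sigma-1)^s$ ($1\le s\le p$) be its indecomposable representations, and let $\mathrm{Ver}_p$ be the quotient of $\mathrm{Rep}_k(C_p)$ by negligible morphisms; $\mathrm{sVec}\subset\mathrm{Ver}_p$ is the subcategory of direct sums of the images of $L_1$ and $L_{p-1}$. The quotient by negligible morphisms of the category $\mathcal C_{C_p}$ of objects of $\mathcal C$ with a $C_p$-action is identified with $\mathcal C\boxtimes\mathrm{Ver}_p$, the object $Y\otimes(V\otimes\mathbf 1)$ (where $C_p$ acts through $V$) corresponding to $Y\boxtimes V$. The Frobenius functor $\mathrm{Fr}:\mathcal C\to\mathcal C^{(1)}\boxtimes\mathrm{Ver}_p$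 is induced by $X\mapsto X^{\otimes p}$, $f\mapsto f^{\otimes p}$, with $\sigma$ acting on $X^{\otimes p}$ by the cyclic permutation of the factors; here $\mathcal C^{(1)}$ is $\mathcal C$ with its $k$-linear structure twisted by the Frobenius automorphism of $k$, which makes $\mathrm{Fr}$ $k$-linear. A fusion subcategory is a full subcategory containing the unit and closed under tensor products, finite direct sums and direct summands. Suppose that $\mathcal C$ is Frobenius injective, i.e. $\mathrm{Fr}$ is fully faithful, and that $\mathcal C$ is of Frobenius type $\mathrm{sVec}$, i.e. $\mathrm{sVec}$ is the smallest fusion subcategory $\mathcal A\subset\mathrm{Ver}_p$ such that $\mathrm{Fr}(X)\in\mathcal C^{(1)}\boxtimes\mathcal A$ for all $X\in\mathcal C$. Then $\mathcal C$ is non-degenerate: $$\dim(\mathcal C)=\sum_X\dim(X)^2\neq 0\quad\text{in } k=\mathrm{End}(\mathbf 1),$$ where $X$ runs over the isomorphism classes of simple objects of $\mathcal C$. -/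

import Mathlib

open CategoryTheory CategoryTheory.Limits MonoidalCategory

universe w v u

namespace SymFus

noncomputable section

/-! ### Trace, dimension, negligible morphisms -/

section Trace

variable {C : Type u} [Category.{v} C] [MonoidalCategory C] [SymmetricCategory C]

/-- The trace of `f : X ⟶ X` for the canonical spherical structure of a symmetric rigid category:
the composite `𝟙 ⟶ X ⊗ Xᘁ ⟶ X ⊗ Xᘁ ⟶ Xᘁ ⊗ X ⟶ 𝟙` of coevaluation, `f`, the
commutativity isomorphism and evaluation.  It takes values in the endomorphism ring of the unit
object, which for a `k`-linear category with `k = End(𝟙)` is `k`. -/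
def trace {X : C} [HasRightDual X] (f : X ⟶ X) : End (𝟙_ C) :=
  η_ X Xᘁ ≫ f ▷ Xᘁ ≫ (β_ X Xᘁ).hom ≫ ε_ X Xᘁ

/-- The dimension of an object: the trace of its identity. -/
def dim (X : C) [HasRightDual X] : End (𝟙_ C) := trace (𝟙 X)

variable [RightRigidCategory C] [Preadditive C]

/-- `f : X ⟶ Y` is negligible if the trace of its composition with any `u : Y ⟶ X` vanishes. -/
def Negligible {X Y : C} (f : X ⟶ Y) : Prop := ∀ u : Y ⟶ X, trace (u ≫ f) = 0

variable (C) in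
/-- Two morphisms are identified in the quotient if their difference is negligible. -/
def negligibleRel : HomRel C := fun _ _ f g => Negligible (f - g)

/-- A trace-free form of negligibility, used to see that negligible morphisms form a tensor
ideal. -/
theorem negligible_iff [MonoidalPreadditive C] {X Y : C} (f : X ⟶ Y) :
    Negligible f ↔ ∀ (W : C) (a : 𝟙_ C ⟶ X ⊗ W) (b : Y ⊗ W ⟶ 𝟙_ C), a ≫ f ▷ W ≫ b = 0 := by
  constructor
  · intro h W a b
    let _ : ExactPairing Yᘁ Y := BraidedCategory.exactPairing_swap Y Yᘁ
    -- every `b` factors through the canonical pairing `Y ⊗ Yᘁ ⟶ 𝟙`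
    obtain ⟨w, hw⟩ : ∃ w : W ⟶ Yᘁ, b = Y ◁ w ≫ (β_ Y Yᘁ).hom ≫ ε_ Y Yᘁ := by
      have e := (tensorLeftHomEquiv W Yᘁ Y (𝟙_ C)).left_inv b
      refine ⟨(tensorLeftHomEquiv W Yᘁ Y (𝟙_ C)) b ≫ (ρ_ _).hom, ?_⟩
      rw [← e]
      generalize (tensorLeftHomEquiv W Yᘁ Y (𝟙_ C)).toFun b = t at *
      have : ((tensorLeftHomEquiv W Yᘁ Y (𝟙_ C)) ((tensorLeftHomEquiv W Yᘁ Y (𝟙_ C)).invFun t))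
          = t := (tensorLeftHomEquiv W Yᘁ Y (𝟙_ C)).right_inv t
      rw [this]
      have hε : ε_ Yᘁ Y = (β_ Y Yᘁ).hom ≫ ε_ Y Yᘁ := rfl
      rw [← hε]
      simp only [tensorLeftHomEquiv, MonoidalCategory.whiskerLeft_comp, Category.assoc]
      monoidal
    -- every `𝟙 ⟶ X ⊗ Yᘁ` comes from some `u : Y ⟶ X`
    obtain ⟨u, hu⟩ : ∃ u : Y ⟶ X, a ≫ X ◁ w = η_ Y Yᘁ ≫ u ▷ Yᘁ := by
      have e := (tensorRightHomEquiv (𝟙_ C) Y Yᘁ X).right_inv (a ≫ X ◁ w)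
      refine ⟨(λ_ _).inv ≫ (tensorRightHomEquiv (𝟙_ C) Y Yᘁ X).invFun (a ≫ X ◁ w), ?_⟩
      conv_lhs => rw [← e]
      generalize (tensorRightHomEquiv (𝟙_ C) Y Yᘁ X).invFun (a ≫ X ◁ w) = t
      simp only [tensorRightHomEquiv, comp_whiskerRight]
      monoidal
    have := h u
    simp only [trace, comp_whiskerRight, Category.assoc] at this
    rw [hw, ← whisker_exchange_assoc, ← Category.assoc, hu]
    simpa using this
  · intro h u
    have := h Yᘁ (η_ Y Yᘁ ≫ u ▷ Yᘁ) ((β_ Y Yᘁ).hom ≫ ε_ Y Yᘁ)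
    simpa [trace] using this

variable [MonoidalPreadditive C]

theorem Negligible.add {X Y : C} {f g : X ⟶ Y} (hf : Negligible f) (hg : Negligible g) :
    Negligible (f + g) := by
  rw [negligible_iff] at *
  intro W a b
  simp [MonoidalPreadditive.add_whiskerRight, hf W a b, hg W a b]

theorem Negligible.neg {X Y : C} {f : X ⟶ Y} (hf : Negligible f) : Negligible (-f) := by
  rw [negligible_iff] at *
  intro W a b
  have := hf W a b
  have h : (-f) ▷ W = -(f ▷ W) := by
    rw [eq_neg_iff_add_eq_zero, ← MonoidalPreadditive.add_whiskerRight]; simp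
  simp [h, this]

theorem Negligible.precomp {X Y Z : C} (g : X ⟶ Y) {f : Y ⟶ Z} (hf : Negligible f) :
    Negligible (g ≫ f) := by
  rw [negligible_iff] at *
  intro W a b
  simpa using hf W (a ≫ g ▷ W) b

theorem Negligible.postcomp {X Y Z : C} {f : X ⟶ Y} (hf : Negligible f) (g : Y ⟶ Z) :
    Negligible (f ≫ g) := by
  rw [negligible_iff] at *
  intro W a b
  simpa using hf W a (g ▷ W ≫ b)

theorem Negligible.whiskerRight {X Y : C} {f : X ⟶ Y} (hf : Negligible f) (Z : C) :
    Negligible (f ▷ Z) := by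
  rw [negligible_iff] at *
  intro W a b
  have := hf (Z ⊗ W) (a ≫ (α_ _ _ _).hom) ((α_ _ _ _).inv ≫ b)
  simpa using this

theorem Negligible.whiskerLeft {X Y : C} {f : X ⟶ Y} (hf : Negligible f) (Z : C) :
    Negligible (Z ◁ f) := by
  have h : Z ◁ f = (β_ Z X).hom ≫ f ▷ Z ≫ (β_ Y Z).hom := by simp
  rw [h]
  exact ((hf.whiskerRight Z).postcomp _).precomp _

instance : Congruence (negligibleRel C) where
  equivalence := {
    refl := fun f => by
      have : Negligible (f - f) := by
        rw [negligible_iff]; intro W a b; simp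
      exact this
    symm := fun {f g} h => by
      have : Negligible (f - g) := h
      have := this.neg
      rwa [neg_sub] at this
    trans := fun {f g e} h₁ h₂ => by
      have h₁ : Negligible (f - g) := h₁
      have h₂ : Negligible (g - e) := h₂
      have := h₁.add h₂
      rwa [sub_add_sub_cancel] at this }
  comp_left {_ _ _} f {g g'} h := by
    have h : Negligible (g - g') := h
    have := h.precomp f
    rwa [Preadditive.comp_sub] at this
  comp_right {_ _ _} {f f'} g h := by
    have h : Negligible (f - f') := h
    have := h.postcomp g
    rwa [Preadditive.sub_comp] at this

end Trace
/-! ### The quotient by negligible morphisms -/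

section NegligibleQuotient

variable (C : Type u) [Category.{v} C] [MonoidalCategory C] [SymmetricCategory C]
  [RightRigidCategory C] [Preadditive C] [MonoidalPreadditive C]

/-- The quotient `C̄` of `C` by the tensor ideal of negligible morphisms. -/
abbrev NegligibleQuotient := Quotient (negligibleRel C)

/-- The quotient functor `C ⥤ C̄`. -/
abbrev toQuotient : C ⥤ NegligibleQuotient C := Quotient.functor (negligibleRel C)

instance : Preadditive (NegligibleQuotient C) :=
  Quotient.preadditive _ (fun _ _ f₁ f₂ g₁ g₂ hf hg => by
    have hf : Negligible (f₁ - f₂) := hf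
    have hg : Negligible (g₁ - g₂) := hg
    have := hf.add hg
    rwa [sub_add_sub_comm] at this)

variable {C}

/-- Whiskering on the left in the quotient category. -/
def quotientWhiskerLeft (X : NegligibleQuotient C) {Y Z : NegligibleQuotient C} (f : Y ⟶ Z) :
    (toQuotient C).obj (X.as ⊗ Y.as) ⟶ (toQuotient C).obj (X.as ⊗ Z.as) :=
  Quot.liftOn f (fun f => (toQuotient C).map (X.as ◁ f)) (fun f g h => by
    rw [HomRel.compClosure_iff_self] at h
    apply CategoryTheory.Quotient.sound
    have h : Negligible (f - g) := h
    have := h.whiskerLeft X.as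
    have e : X.as ◁ (f - g) = X.as ◁ f - X.as ◁ g :=
      (tensorLeft X.as).map_sub
    rwa [e] at this)

/-- Whiskering on the right in the quotient category. -/
def quotientWhiskerRight {Y Z : NegligibleQuotient C} (f : Y ⟶ Z) (X : NegligibleQuotient C) :
    (toQuotient C).obj (Y.as ⊗ X.as) ⟶ (toQuotient C).obj (Z.as ⊗ X.as) :=
  Quot.liftOn f (fun f => (toQuotient C).map (f ▷ X.as)) (fun f g h => by
    rw [HomRel.compClosure_iff_self] at h
    apply CategoryTheory.Quotient.sound
    have h : Negligible (f - g) := h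
    have := h.whiskerRight X.as
    have e : (f - g) ▷ X.as = f ▷ X.as - g ▷ X.as :=
      (tensorRight X.as).map_sub
    rwa [e] at this)

/-- The tensor product of `C` descends to the quotient. -/
instance : MonoidalCategory (NegligibleQuotient C) where
  tensorObj X Y := (toQuotient C).obj (X.as ⊗ Y.as)
  tensorUnit := (toQuotient C).obj (𝟙_ C)
  whiskerLeft X _ _ f := quotientWhiskerLeft X f
  whiskerRight f X := quotientWhiskerRight f X
  tensorHom f g := quotientWhiskerRight f _ ≫ quotientWhiskerLeft _ g
  associator X Y Z := (toQuotient C).mapIso (α_ X.as Y.as Z.as)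
  leftUnitor X := (toQuotient C).mapIso (λ_ X.as)
  rightUnitor X := (toQuotient C).mapIso (ρ_ X.as)
  tensorHom_def _ _ := rfl
  id_tensorHom_id X Y := by
    refine (congrArg (toQuotient C).map (?_ : 𝟙 X.as ▷ Y.as ≫ X.as ◁ 𝟙 Y.as = 𝟙 _))
    simp
  tensorHom_comp_tensorHom := by
    rintro X₁ Y₁ Z₁ X₂ Y₂ Z₂ ⟨f₁⟩ ⟨f₂⟩ ⟨g₁⟩ ⟨g₂⟩
    refine congrArg (toQuotient C).map (?_ : (f₁ ▷ X₂.as ≫ Y₁.as ◁ f₂) ≫ (g₁ ▷ Y₂.as ≫ Z₁.as ◁ g₂)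
      = (f₁ ≫ g₁) ▷ X₂.as ≫ Z₁.as ◁ (f₂ ≫ g₂))
    simp [whisker_exchange_assoc]
  whiskerLeft_id X Y := congrArg (toQuotient C).map (MonoidalCategory.whiskerLeft_id X.as Y.as)
  id_whiskerRight X Y := congrArg (toQuotient C).map (MonoidalCategory.id_whiskerRight X.as Y.as)
  associator_naturality := by
    rintro X₁ X₂ X₃ Y₁ Y₂ Y₃ ⟨f₁⟩ ⟨f₂⟩ ⟨f₃⟩
    refine congrArg (toQuotient C).map (?_ :
      ((f₁ ▷ X₂.as ≫ Y₁.as ◁ f₂) ▷ X₃.as ≫ (Y₁.as ⊗ Y₂.as) ◁ f₃) ≫ (α_ _ _ _).hom =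
      (α_ _ _ _).hom ≫ (f₁ ▷ (X₂.as ⊗ X₃.as) ≫ Y₁.as ◁ (f₂ ▷ X₃.as ≫ Y₂.as ◁ f₃)))
    simp
  leftUnitor_naturality := by
    rintro X Y ⟨f⟩
    exact congrArg (toQuotient C).map (MonoidalCategory.leftUnitor_naturality f)
  rightUnitor_naturality := by
    rintro X Y ⟨f⟩
    exact congrArg (toQuotient C).map (MonoidalCategory.rightUnitor_naturality f)
  pentagon W X Y Z :=
    congrArg (toQuotient C).map (MonoidalCategory.pentagon W.as X.as Y.as Z.as)
  triangle X Y := congrArg (toQuotient C).map (MonoidalCategory.triangle X.as Y.as)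

end NegligibleQuotient

/-! ### Tensor powers and the cyclic permutation -/

section TensorPower

variable {C : Type u} [Category.{v} C] [MonoidalCategory C]

/-- The tensor power `X ⊗ (X ⊗ (⋯ ⊗ 𝟙))` with `n` factors `X`. -/
@[reducible] def tensorPow (X : C) : ℕ → C
  | 0 => 𝟙_ C
  | n + 1 => X ⊗ tensorPow X n

/-- `f ⊗ f ⊗ ⋯ ⊗ f` with `n` factors. -/
def tensorPowMap {X Y : C} (f : X ⟶ Y) : ∀ n, tensorPow X n ⟶ tensorPow Y n
  | 0 => 𝟙 _
  | n + 1 => f ⊗ₘ tensorPowMap f n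

/-- The canonical isomorphism of `(X ⊗ ⋯ ⊗ X) ⊗ X` with `X ⊗ (X ⊗ ⋯ ⊗ X)` given by the
associativity and unit constraints alone: it preserves the order of the factors. -/
def tensorPowSnoc (X : C) : ∀ n, tensorPow X n ⊗ X ≅ tensorPow X (n + 1)
  | 0 => λ_ X ≪≫ (ρ_ X).symm
  | n + 1 => α_ _ _ _ ≪≫ whiskerLeftIso X (tensorPowSnoc X n)

theorem tensorPowMap_id (X : C) (n : ℕ) : tensorPowMap (𝟙 X) n = 𝟙 _ := by
  induction n with
  | zero => rfl
  | succ n ih => simp [tensorPowMap, ih, tensorPow]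

theorem tensorPowMap_comp {X Y Z : C} (f : X ⟶ Y) (g : Y ⟶ Z) (n : ℕ) :
    tensorPowMap (f ≫ g) n = tensorPowMap f n ≫ tensorPowMap g n := by
  induction n with
  | zero => simp [tensorPowMap]
  | succ n ih => simp [tensorPowMap, ih]

theorem tensorPowSnoc_naturality {X Y : C} (f : X ⟶ Y) (n : ℕ) :
    (tensorPowMap f n ⊗ₘ f) ≫ (tensorPowSnoc Y n).hom =
      (tensorPowSnoc X n).hom ≫ tensorPowMap f (n + 1) := by
  induction n with
  | zero => simp [tensorPowMap, tensorPowSnoc, MonoidalCategory.tensorHom_def]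
  | succ n ih =>
    have : tensorPowMap f (n + 1 + 1) = f ⊗ₘ tensorPowMap f (n + 1) := rfl
    simp only [tensorPowSnoc, Iso.trans_hom, whiskerLeftIso_hom, Category.assoc, this]
    have h2 : tensorPowMap f (n + 1) = f ⊗ₘ tensorPowMap f n := rfl
    rw [← id_tensorHom, ← id_tensorHom, MonoidalCategory.tensorHom_comp_tensorHom,
      Category.id_comp, ← ih, h2, associator_naturality_assoc,
      MonoidalCategory.tensorHom_comp_tensorHom, Category.comp_id]

/-- `IsConcat X a b n f` says that `f` is the isomorphism `X^{⊗ a} ⊗ X^{⊗ b} ⟶ X^{⊗ n}`,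
`n = a + b`, given by the associativity and unit constraints. -/
inductive IsConcat (X : C) : ∀ a b n, (tensorPow X a ⊗ tensorPow X b ⟶ tensorPow X n) → Prop
  | zero (b : ℕ) : IsConcat X 0 b b (λ_ _).hom
  | succ (a b n : ℕ) (f : tensorPow X a ⊗ tensorPow X b ⟶ tensorPow X n) :
      IsConcat X a b n f → IsConcat X (a + 1) b (n + 1) ((α_ _ _ _).hom ≫ X ◁ f)

theorem IsConcat.exists (X : C) (a b : ℕ) : ∃ n f, IsConcat X a b n f ∧ n = a + b := by
  induction a with
  | zero => exact ⟨_, _, .zero b, by simp⟩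
  | succ a ih =>
    obtain ⟨n, f, h, e⟩ := ih
    exact ⟨_, _, .succ a b n f h, by omega⟩

theorem IsConcat.snoc {X : C} {a b n : ℕ} {f} (h : IsConcat X a b n f) :
    ∃ g, IsConcat X a (b + 1) (n + 1) g ∧
      tensorPow X a ◁ (tensorPowSnoc X b).hom ≫ g =
        (α_ _ _ _).inv ≫ f ▷ X ≫ (tensorPowSnoc X n).hom := by
  induction h with
  | zero b =>
    refine ⟨_, .zero (b + 1), ?_⟩
    rw [MonoidalCategory.leftUnitor_naturality]
    simp [tensorPow]
  | succ a b n f h ih =>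
    obtain ⟨g, hg, e⟩ := ih
    refine ⟨_, .succ _ _ _ _ hg, ?_⟩
    simp only [tensorPow, tensorPowSnoc, Iso.trans_hom, whiskerLeftIso_hom] at e ⊢
    rw [associator_naturality_right_assoc, ← MonoidalCategory.whiskerLeft_comp, e]
    simp

theorem IsConcat.shift {X : C} (c : ℕ) : ∀ {a n : ℕ} {f}, IsConcat X (c + 1) a n f →
    ∃ g, IsConcat X c (a + 1) n g ∧
      (tensorPowSnoc X c).hom ▷ tensorPow X a ≫ f = (α_ _ _ _).hom ≫ g := by
  induction c with
  | zero =>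
    rintro a n f (_ | ⟨_, _, n, f, h⟩)
    cases h
    refine ⟨_, .zero _, ?_⟩
    simp [tensorPowSnoc, tensorPow]
  | succ c ih =>
    rintro a n f (_ | ⟨_, _, n, f, h⟩)
    obtain ⟨g, hg, e⟩ := ih h
    refine ⟨_, .succ _ _ _ _ hg, ?_⟩
    simp only [tensorPow, tensorPowSnoc, Iso.trans_hom, whiskerLeftIso_hom] at e ⊢
    have := congrArg (fun t => X ◁ t) e
    simp only [MonoidalCategory.whiskerLeft_comp] at this
    simp [this]

variable [SymmetricCategory C]

/-- The automorphism of the `n`-th tensor power given by the cyclic permutation of the factors: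
the first factor is moved to the last place by the commutativity isomorphism. -/
def rotate (X : C) : ∀ n, End (tensorPow X n)
  | 0 => 𝟙 _
  | n + 1 => (β_ X (tensorPow X n)).hom ≫ (tensorPowSnoc X n).hom

theorem rotate_naturality {X Y : C} (f : X ⟶ Y) (n : ℕ) :
    (rotate X n : tensorPow X n ⟶ _) ≫ tensorPowMap f n = tensorPowMap f n ≫ rotate Y n := by
  cases n with
  | zero => simp [rotate, tensorPowMap]
  | succ n =>
    simp only [rotate, Category.assoc]
    rw [← tensorPowSnoc_naturality, ← BraidedCategory.braiding_naturality_assoc]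
    rfl

theorem rotate_pow_naturality {X Y : C} (f : X ⟶ Y) (n m : ℕ) :
    (rotate X n ^ m : End (tensorPow X n)) ≫ tensorPowMap f n =
      tensorPowMap f n ≫ (rotate Y n ^ m : End (tensorPow Y n)) := by
  induction m with
  | zero => simp [End.one_def]
  | succ m ih =>
    rw [pow_succ, pow_succ, End.mul_def, End.mul_def, Category.assoc, ih,
      ← Category.assoc, rotate_naturality, Category.assoc]

theorem braiding_shift (X A B : C) :
    (α_ X A B).hom ≫ (β_ X (A ⊗ B)).hom ≫ (α_ A B X).hom ≫ (β_ A (B ⊗ X)).hom ≫ (α_ B X A).hom =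
      (β_ (X ⊗ A) B).hom := by
  have h1 : (α_ A B X).hom ≫ (β_ A (B ⊗ X)).hom ≫ (α_ B X A).hom =
      (β_ A B).hom ▷ X ≫ (α_ _ _ _).hom ≫ B ◁ (β_ A X).hom := by
    simp [BraidedCategory.braiding_tensor_right_hom]
  rw [h1, ← BraidedCategory.braiding_naturality_right_assoc,
    BraidedCategory.braiding_tensor_right_hom, BraidedCategory.braiding_tensor_left_hom]
  simp [← MonoidalCategory.whiskerLeft_comp]

theorem IsConcat.rotate_pow {X : C} (a : ℕ) : ∀ {b n : ℕ} {f}, IsConcat X a b n f →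
    ∃ g, IsConcat X b a n g ∧
      f ≫ (rotate X n ^ a : End (tensorPow X n)) = (β_ _ _).hom ≫ g := by
  induction a with
  | zero =>
    rintro b n f h
    cases h
    suffices H : ∀ b, IsConcat X b 0 b (ρ_ _).hom by
      refine ⟨_, H _, ?_⟩
      rw [pow_zero, End.one_def, Category.comp_id]
      simp [tensorPow]
    intro b
    induction b with
    | zero =>
      have := IsConcat.zero (X := X) 0
      rwa [show (λ_ (tensorPow X 0)).hom = (ρ_ (tensorPow X 0)).hom from unitors_equal] at this
    | succ b ih =>
      have := IsConcat.succ _ _ _ _ ih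
      have e : (α_ X (tensorPow X b) (tensorPow X 0)).hom ≫ X ◁ (ρ_ _).hom =
        (ρ_ (X ⊗ tensorPow X b)).hom := by simp [tensorPow]
      rwa [e] at this
  | succ a ih =>
    rintro c n f (_ | ⟨_, _, n, f, h⟩)
    obtain ⟨g, hg, e⟩ := h.snoc
    obtain ⟨g', hg', e'⟩ := ih hg
    obtain ⟨g'', hg'', e''⟩ := IsConcat.shift c hg'
    refine ⟨g'', hg'', ?_⟩
    have e2 : f ▷ X ≫ (tensorPowSnoc X n).hom =
        (α_ _ _ _).hom ≫ _ ◁ (tensorPowSnoc X c).hom ≫ g := by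
      rw [e]; simp
    rw [pow_succ, End.mul_def]
    simp only [rotate, Category.assoc] at e' ⊢
    rw [BraidedCategory.braiding_naturality_right_assoc, reassoc_of% e2, e',
      BraidedCategory.braiding_naturality_right_assoc, e'']
    have := congrArg (fun t => t ≫ g'') (braiding_shift X (tensorPow X _) (tensorPow X c))
    simp only [Category.assoc] at this
    exact this

/-- The `n`-fold iterate of the cyclic permutation of `n` factors is the identity. -/
theorem rotate_pow_self (X : C) (n : ℕ) : rotate X n ^ n = 1 := by
  obtain ⟨m, f, h, e⟩ := IsConcat.exists X n 0
  obtain rfl : m = n := by simpa using e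
  have hf : ∀ {a n f}, IsConcat X a 0 n f → ∃ e : a = n, f = (ρ_ _).hom ≫ eqToHom (by rw [e]) := by
    intro a
    induction a with
    | zero =>
      intro n f h
      cases h
      exact ⟨rfl, by simp [unitors_equal]⟩
    | succ a ih =>
      rintro n f (_ | ⟨_, _, n, f, h⟩)
      obtain ⟨rfl, rfl⟩ := ih h
      exact ⟨rfl, by simp⟩
  obtain ⟨_, hf⟩ := hf h
  obtain ⟨g, hg, e⟩ := h.rotate_pow
  cases hg
  rw [hf] at e
  simp only [eqToHom_refl, Category.comp_id, braiding_leftUnitor] at e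
  rw [← cancel_epi (ρ_ (tensorPow X m)).hom, e]
  simp [End.one_def]

end TensorPower

/-! ### Frobenius functor -/

section Frobenius

/-- The cyclic group of order `p`. -/
abbrev Cyc (p : ℕ) := Multiplicative (ZMod p)

variable (C : Type u) [Category.{v} C] [MonoidalCategory C] [SymmetricCategory C]

/-- The functor `P₁` from `C` to the category of objects of `C` with an action of the cyclic group
of order `p`: it sends `X` to `X^{⊗ p}`, where the generator acts by the cyclic permutation of the
factors, and `f` to `f^{⊗ p}`. -/
def cyclicPower (p : ℕ) [NeZero p] : C ⥤ Action C (Cyc p) where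
  obj X :=
    { V := tensorPow X p
      ρ :=
        { toFun := fun g => rotate X p ^ (Multiplicative.toAdd g).val
          map_one' := by simp
          map_mul' := fun g h => by
            rw [toAdd_mul, ZMod.val_add, ← pow_add,
              pow_eq_pow_mod ((Multiplicative.toAdd g).val + (Multiplicative.toAdd h).val)
                (rotate_pow_self X p)] } }
  map f :=
    { hom := tensorPowMap f p
      comm := fun g => rotate_pow_naturality f p _ }
  map_id X := by ext; exact tensorPowMap_id X p
  map_comp f g := by ext; exact tensorPowMap_comp f g p

variable [RightRigidCategory C] [Preadditive C] [MonoidalPreadditive C]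

/-- The quotient by the negligible morphisms of the category of objects of `C` with an action of
the cyclic group of order `p`.  For a symmetric fusion category `C` this is the external tensor
product `C ⊠ Ver_p`, with `Y ⊠ V` given by the object `box Y V` below. -/
abbrev CyclicQuotient (p : ℕ) := NegligibleQuotient (Action C (Cyc p))

/-- The Frobenius functor `X ↦ X^{⊗ p}` from `C` to `C ⊠ Ver_p`.  It satisfies
`Fr (c • f) = c ^ p • Fr f`; replacing `C` by its Frobenius twist in the target, which changes only
the action of the scalars on morphisms, makes it `k`-linear. -/
def frobenius (p : ℕ) [NeZero p] : C ⥤ CyclicQuotient C p :=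
  cyclicPower C p ⋙ toQuotient (Action C (Cyc p))

end Frobenius

attribute [local instance] Abelian.hasFiniteBiproducts

/-! ### The universal Verlinde category -/

section Verlinde

variable (k : Type w) [Field k] (p : ℕ)

/-- The universal Verlinde category: the quotient of the category of finite dimensional
representations of the cyclic group of order `p` by the negligible morphisms. -/
abbrev Ver := NegligibleQuotient (FDRep k (Cyc p))

variable [NeZero p]

/-- The ring `k[σ]/(σ - 1)^s`, as a quotient of the group algebra of the cyclic group of
order `p` with generator `σ`. -/
abbrev JordanRing (s : ℕ) :=
  MonoidAlgebra k (Cyc p) ⧸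
    Ideal.span {((MonoidAlgebra.of k (Cyc p) (Multiplicative.ofAdd 1) - 1) ^ s :
      MonoidAlgebra k (Cyc p))}

/-- The representation `L_s = k[σ]/(σ - 1)^s` of the cyclic group of order `p`, on which `σ` acts
by multiplication. -/
def jordanRep (s : ℕ) : FDRep k (Cyc p) :=
  FDRep.of (V := JordanRing k p s)
    ((Algebra.lmul k (JordanRing k p s)).toMonoidHom.comp
      ((Ideal.Quotient.mk _).toMonoidHom.comp (MonoidAlgebra.of k (Cyc p))))

/-- The subcategory `sVec` of `Ver_p`: the direct sums of copies of the images of `L_1` and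
`L_{p-1}`. -/
def sVec : ObjectProperty (Ver k p) := fun X =>
  ∃ (n : ℕ) (s : Fin n → ℕ), (∀ i, s i = 1 ∨ s i = p - 1) ∧
    Nonempty (X ≅ (toQuotient (FDRep k (Cyc p))).obj (⨁ fun i => jordanRep k p (s i)))

end Verlinde

/-- A fusion subcategory: a full subcategory containing the unit object and closed under tensor
products, finite direct sums and direct summands. -/
structure IsFusionSubcategory {D : Type u} [Category.{v} D] [Preadditive D] [MonoidalCategory D]
    (A : ObjectProperty D) : Prop where
  unit : A (𝟙_ D)
  tensor : ∀ X Y, A X → A Y → A (X ⊗ Y)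
  directSum : ∀ {X Y} (b : BinaryBicone X Y), Nonempty b.IsBilimit → A X → A Y → A b.pt
  summand : ∀ {X Y}, Nonempty (Retract X Y) → A Y → A X

/-! ### Symmetric fusion categories -/

section Fusion

variable (k : Type w) [Field k] (C : Type u) [Category.{v} C] [Abelian C] [Linear k C]
  [MonoidalCategory C]

/-- The conditions of semisimplicity and finiteness that make a `k`-linear abelian rigid monoidal
category a fusion category. -/
class IsFusion : Prop where
  finite_hom : ∀ X Y : C, Module.Finite k (X ⟶ Y)
  semisimple : ∀ X : C, ∃ (n : ℕ) (S : Fin n → C), (∀ i, Simple (S i)) ∧ Nonempty (X ≅ ⨁ S)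
  finite_simple : Finite {X : Skeleton C // Simple ((fromSkeleton C).obj X)}
  simple_unit : Simple (𝟙_ C)

/-- The functor `V ↦ V ⊗ 𝟙` from finite dimensional vector spaces to `C`, computed in a basis
of `V`. -/
def vecTensor : FGModuleCat.{w} k ⥤ C where
  obj V := ⨁ fun _ : Fin (Module.finrank k V) => 𝟙_ C
  map {V W} f := biproduct.matrix fun i j =>
    LinearMap.toMatrix (Module.finBasis k V) (Module.finBasis k W) f.hom.hom j i • 𝟙 (𝟙_ C)
  map_id V := by
    ext i j
    by_cases h : i = j
    · subst h
      simp
    · simp [h, Ne.symm h]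
  map_comp {U V W} f g := by
    ext i j
    have h := LinearMap.toMatrix_comp (Module.finBasis k U) (Module.finBasis k V)
      (Module.finBasis k W) g.hom.hom f.hom.hom
    simp [h, biproduct.lift_desc, Matrix.mul_apply, Finset.sum_smul, smul_smul, mul_comm]

variable [SymmetricCategory C] [RightRigidCategory C] [MonoidalPreadditive C]

/-- The dimension of `C`: the sum of the squares of the dimensions of the simple objects, up to
isomorphism. -/
def globalDim : End (𝟙_ C) :=
  ∑ᶠ X : {X : Skeleton C // Simple ((fromSkeleton C).obj X)}, dim ((fromSkeleton C).obj X.1) ^ 2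

/-- `C` is non-degenerate if its dimension is nonzero. -/
def IsNonDegenerate : Prop := globalDim C ≠ 0

variable (p : ℕ) [NeZero p]

/-- `Y ⊠ V` before passing to the quotient: the object `Y ⊗ (V ⊗ 𝟙)`, where the cyclic group acts
through `V`. -/
def box (Y : C) (V : FDRep k (Cyc p)) : Action C (Cyc p) :=
  Action.trivial (Cyc p) Y ⊗ ((vecTensor k C).mapAction (Cyc p)).obj V

/-- For a subcategory `A` of `Ver_p`, the subcategory `C ⊠ A` of `C ⊠ Ver_p`: the direct summands of
finite direct sums of the objects `Y ⊠ V` with `Y` in `C` and `V` in `A`. -/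
def boxSubcategory (A : ObjectProperty (Ver k p)) : ObjectProperty (CyclicQuotient C p) := fun Z =>
  ∃ (n : ℕ) (Y : Fin n → C) (V : Fin n → FDRep k (Cyc p)),
    (∀ i, A ((toQuotient (FDRep k (Cyc p))).obj (V i))) ∧
    Nonempty (Retract Z ((toQuotient (Action C (Cyc p))).obj (⨁ fun i => box k C p (Y i) (V i))))

/-- `C` is Frobenius injective if its Frobenius functor is fully faithful. -/
def IsFrobeniusInjective : Prop := (frobenius C p).Full ∧ (frobenius C p).Faithful

/-- `C` is of Frobenius type `A` if `A` is the smallest fusion subcategory of `Ver_p` such that the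
image of the Frobenius functor is contained in `C ⊠ A`. -/
def HasFrobeniusType (A : ObjectProperty (Ver k p)) : Prop :=
  IsLeast {B : ObjectProperty (Ver k p) | IsFusionSubcategory B ∧
    ∀ X : C, boxSubcategory k C p B ((frobenius C p).obj X)} A

end Fusion

end

end SymFus

namespace SymFus

noncomputable section

set_option linter.unusedSectionVars false

attribute [local instance] Abelian.hasFiniteBiproducts

/-! Suppose `dim C = 0` and compare two computations of a `p`-th power in `k ⊗ K₀(C)`. Put `U = ∑
dim(X)[X]`, summed over the simple objects. Multiplication by `U` has matrix `(dim a · dim b)`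
(`sum_sdim_smul_mulMatrix`), so `U² = dim(C) U = 0` and `U^p = 0`. The Grothendieck ring is
commutative and the characteristic is `p`, so also `U^p = ∑ dim(X)^p [X]^p = ∑ dim(X^{⊗p})
[X^{⊗p}]`. Reading off the coefficient of the unit gives `∑ dim(X^{⊗p}) [X^{⊗p} : 𝟙] = 0` in `k`
(`sum_sdim_tensorPow_mul_homDim_eq_zero`).

The Frobenius functor evaluates each term. Full faithfulness makes `End(Fr X)` consist of scalars
for simple `X`, and since `Fr X` lies in `C ⊠ sVec` it is a retract of some `Y ⊠ L_s` with `Y`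
simple and `s = 1` or `s = p - 1` (`exists_quotientRetract_box`). Negligible morphisms have trace
zero even when composed with a natural endomorphism of the identity functor. Hence both the
dimension of `X^{⊗p}` and the multiplicity mod `p` of the unit, which is the trace of the natural
projection `unitProj`, can be computed on `Y ⊠ L_s`. If the multiplicity is nonzero in `k`, then `Y
≅ 𝟙` and both numbers equal `s`, so the term is `s² = 1` (`eigenvalue_of_quotientRetract`).

The sum therefore counts the simple `X` with `[X^{⊗p} : 𝟙] ≠ 0` in `k`. Each value of `s` comes from
at most one such `X`, by `nonempty_iso_of_quotientRetract`, and `X = 𝟙` is one of them. The count is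
`1` or `2`, which is nonzero in `k` as `p > 2`: a contradiction. -/

/-! ### Cyclicity and multiplicativity of the trace -/

section Trace

variable {C : Type u} [Category.{v} C] [MonoidalCategory C] [SymmetricCategory C]

/-- Cyclicity of the trace.  Applied to two dualities for the same object it also shows that the
trace does not depend on the choice of the dual. -/
theorem trace_comp_comm {X Y : C} [HasRightDual X] [HasRightDual Y] (f : X ⟶ Y) (g : Y ⟶ X) :
    trace (f ≫ g) = trace (g ≫ f) := by
  simp only [trace, comp_whiskerRight, Category.assoc]
  rw [← coevaluation_comp_rightAdjointMate_assoc, whisker_exchange_assoc,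
    BraidedCategory.braiding_naturality_right_assoc, rightAdjointMate_comp_evaluation]
  simp only [BraidedCategory.braiding_naturality_left_assoc]

theorem trace_congr_dual {X : C} (i j : HasRightDual X) (f : X ⟶ X) :
    @trace C _ _ _ X i f = @trace C _ _ _ X j f := by
  have := @trace_comp_comm C _ _ _ X X i j f (𝟙 X)
  simpa using this

theorem trace_unit [HasRightDual (𝟙_ C)] (f : 𝟙_ C ⟶ 𝟙_ C) : trace f = f := by
  rw [trace_congr_dual _ ⟨𝟙_ C⟩ f]
  have h : (β_ (𝟙_ C) (𝟙_ C)).hom = 𝟙 _ := by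
    rw [braiding_tensorUnit_left, unitors_equal]; simp
  change (ρ_ (𝟙_ C)).inv ≫ f ▷ 𝟙_ C ≫ (β_ (𝟙_ C) (𝟙_ C)).hom ≫ (ρ_ (𝟙_ C)).hom = f
  rw [h]
  simp

/-- Twisting the pairings by the braiding makes `X` a dual of `Xᘁ`. With this choice of dual the
loop for `Xᘁ` differs from the loop for `X` only by a double braiding, which is trivial in a
symmetric category. -/
theorem dim_rightDual (X : C) [HasRightDual X] [HasRightDual (Xᘁ)] : dim (Xᘁ) = dim X := by
  let _ : ExactPairing Xᘁ X := BraidedCategory.exactPairing_swap X Xᘁ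
  have h := trace_congr_dual inferInstance ⟨X⟩ (𝟙 (HasRightDual.rightDual X))
  rw [dim, h]
  change (η_ X Xᘁ ≫ (β_ Xᘁ X).inv) ≫ 𝟙 Xᘁ ▷ X ≫ (β_ Xᘁ X).hom ≫ ((β_ X Xᘁ).hom ≫ ε_ X Xᘁ) = _
  simp [dim, trace, SymmetricCategory.braiding_swap_eq_inv_braiding Xᘁ X]

/-- The graphical step behind multiplicativity of dimensions: two crossed caps can be pulled apart
into nested ones. -/
theorem slide_pairing {X X' Y Y' : C} (a : X ⊗ X' ⟶ 𝟙_ C) (e : Y' ⊗ Y ⟶ 𝟙_ C) :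
    (X ◁ Y' ◁ (β_ Y X').hom ⊗≫ (β_ X Y').hom ▷ X' ▷ Y ⊗≫ Y' ◁ a ▷ Y ⊗≫ e :
      X ⊗ Y' ⊗ Y ⊗ X' ⟶ 𝟙_ C) = 𝟙 _ ⊗≫ X ◁ e ▷ X' ⊗≫ a := by
  -- Naturality of the braiding moves `Y` from the right of the cap `a` to its left, at the cost of
  -- crossing both legs of `a`.
  have h : a ▷ Y = 𝟙 _ ⊗≫ X ◁ (β_ X' Y).hom ⊗≫ (β_ X Y).hom ▷ X' ⊗≫ Y ◁ a ⊗≫ 𝟙 _ := by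
    have := BraidedCategory.braiding_naturality_left a Y
    rw [BraidedCategory.braiding_tensor_left_hom, braiding_tensorUnit_left] at this
    rw [← cancel_mono ((λ_ Y).hom ≫ (ρ_ Y).inv), this]
    monoidal
  rw [h]
  calc
    _ = 𝟙 _ ⊗≫ ((X ⊗ Y') ◁ (β_ Y X').hom ≫ (β_ X Y').hom ▷ (X' ⊗ Y)) ⊗≫ Y' ◁ X ◁ (β_ X' Y).hom ⊗≫
        Y' ◁ (β_ X Y).hom ▷ X' ⊗≫ Y' ◁ Y ◁ a ⊗≫ e := by monoidal
    _ = 𝟙 _ ⊗≫ (β_ X Y').hom ▷ (Y ⊗ X') ⊗≫ Y' ◁ X ◁ ((β_ Y X').hom ≫ (β_ X' Y).hom) ⊗≫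
        Y' ◁ (β_ X Y).hom ▷ X' ⊗≫ ((Y' ⊗ Y) ◁ a ≫ e ▷ 𝟙_ C) ⊗≫ 𝟙 _ := by
      rw [whisker_exchange]
      monoidal
    -- The two crossings of `Y` with `X'` cancel by symmetry, and the crossings of `X` with `Y'` and
    -- `Y` merge into one, across which `e` then slides.
    _ = 𝟙 _ ⊗≫ ((β_ X (Y' ⊗ Y)).hom ≫ e ▷ X) ▷ X' ⊗≫ a := by
      rw [whisker_exchange, SymmetricCategory.symmetry, BraidedCategory.braiding_tensor_right_hom]
      monoidal
    _ = _ := by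
      rw [← BraidedCategory.braiding_naturality_right, braiding_tensorUnit_right]
      monoidal

/-- A closed inner loop is an endomorphism of the unit, and can be taken out of the loop that
surrounds it. -/
theorem whiskered_unit_end {X X' : C} (a : 𝟙_ C ⟶ X ⊗ X') (b : X ⊗ X' ⟶ 𝟙_ C) (s : 𝟙_ C ⟶ 𝟙_ C) :
    a ⊗≫ X ◁ s ▷ X' ⊗≫ b = (a ≫ b) ≫ s := by
  have h := BraidedCategory.braiding_naturality_right X s
  replace h : X ◁ s = (ρ_ X).hom ≫ (λ_ X).inv ≫ s ▷ X ≫ (λ_ X).hom ≫ (ρ_ X).inv := by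
    simp only [braiding_tensorUnit_right] at h
    rw [← cancel_mono ((ρ_ X).hom ≫ (λ_ X).inv), h]
    simp
  calc
    _ = a ⊗≫ (X ◁ s) ▷ X' ⊗≫ b := by monoidal
    _ = 𝟙 _ ⊗≫ (𝟙_ C ◁ a ≫ s ▷ (X ⊗ X')) ⊗≫ b := by
      rw [h]
      monoidal
    _ = 𝟙 _ ⊗≫ (s ▷ 𝟙_ C ≫ 𝟙_ C ◁ (a ≫ b)) ⊗≫ 𝟙 _ := by
      rw [whisker_exchange]
      monoidal
    _ = 𝟙 _ ⊗≫ (𝟙_ C ◁ (a ≫ b) ≫ s ▷ 𝟙_ C) ⊗≫ 𝟙 _ := by rw [whisker_exchange]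
    _ = _ := by
      have : 𝟙_ C ◁ (a ≫ b) = (λ_ _).hom ≫ (a ≫ b) ≫ (λ_ _).inv := by simp
      have h' : s ▷ 𝟙_ C = (ρ_ _).hom ≫ s ≫ (ρ_ _).inv := by simp
      rw [this, h']
      monoidal

/-- Computed with the dual `Yᘁ ⊗ Xᘁ`, the trace is two entangled loops. `slide_pairing` turns them
into nested loops and `whiskered_unit_end` separates these. -/
theorem dim_tensor (X Y : C) [HasRightDual X] [HasRightDual Y] [HasRightDual (X ⊗ Y)] :
    dim (X ⊗ Y) = dim X ≫ dim Y := by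
  have h := trace_congr_dual inferInstance (HasRightDual.mk (X := X ⊗ Y)
    (HasRightDual.rightDual Y ⊗ HasRightDual.rightDual X)) (𝟙 (X ⊗ Y))
  rw [dim, h]
  change η_ (X ⊗ Y) (Yᘁ ⊗ Xᘁ) ≫ 𝟙 _ ▷ _ ≫ (β_ (X ⊗ Y) (Yᘁ ⊗ Xᘁ)).hom ≫ ε_ (X ⊗ Y) (Yᘁ ⊗ Xᘁ) = _
  rw [ExactPairing.tensor_coevaluation, ExactPairing.tensor_evaluation]
  calc
    _ = η_ X Xᘁ ⊗≫ X ◁ η_ Y Yᘁ ▷ Xᘁ ⊗≫ X ◁ (β_ Y Yᘁ).hom ▷ Xᘁ ⊗≫ (X ◁ Yᘁ ◁ (β_ Y Xᘁ).hom ⊗≫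
        (β_ X Yᘁ).hom ▷ Xᘁ ▷ Y ⊗≫ Yᘁ ◁ ((β_ X Xᘁ).hom ≫ ε_ X Xᘁ) ▷ Y ⊗≫ ε_ Y Yᘁ) := by
      rw [BraidedCategory.braiding_tensor_left_hom, BraidedCategory.braiding_tensor_right_hom,
        BraidedCategory.braiding_tensor_right_hom]
      monoidal
    _ = η_ X Xᘁ ⊗≫ X ◁ η_ Y Yᘁ ▷ Xᘁ ⊗≫ X ◁ (β_ Y Yᘁ).hom ▷ Xᘁ ⊗≫ X ◁ ε_ Y Yᘁ ▷ Xᘁ ⊗≫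
        ((β_ X Xᘁ).hom ≫ ε_ X Xᘁ) := by
      rw [slide_pairing]
      monoidal
    _ = η_ X Xᘁ ⊗≫ X ◁ (dim Y : 𝟙_ C ⟶ 𝟙_ C) ▷ Xᘁ ⊗≫ ((β_ X Xᘁ).hom ≫ ε_ X Xᘁ) := by
      simp only [dim, trace]
      monoidal
    _ = _ := by
      rw [whiskered_unit_end]
      simp [dim, trace]

variable [Preadditive C] [MonoidalPreadditive C]

theorem trace_add {X : C} [HasRightDual X] (f g : X ⟶ X) : trace (f + g) = trace f + trace g := by
  simp [trace, MonoidalPreadditive.add_whiskerRight]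

theorem trace_zero {X : C} [HasRightDual X] : trace (0 : X ⟶ X) = 0 := by
  simp [trace]

theorem trace_sub {X : C} [HasRightDual X] (f g : X ⟶ X) : trace (f - g) = trace f - trace g := by
  rw [eq_sub_iff_add_eq, ← trace_add, sub_add_cancel]

theorem trace_sum {ι : Type*} (s : Finset ι) {X : C} [HasRightDual X] (f : ι → (X ⟶ X)) :
    trace (∑ i ∈ s, f i) = ∑ i ∈ s, trace (f i) := by
  induction s using Finset.cons_induction with
  | empty => simp [trace_zero]
  | cons a s ha ih => rw [Finset.sum_cons, trace_add, ih, Finset.sum_cons]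

theorem trace_smul {k : Type w} [Field k] [Linear k C] [MonoidalLinear k C] {X : C}
    [HasRightDual X] (c : k) (f : X ⟶ X) : trace (c • f) = c • (trace f : 𝟙_ C ⟶ 𝟙_ C) := by
  simp [trace]

end Trace

/-- Forgetting the action preserves tensor products and braidings strictly, so it carries a dual of
`A` to a dual of `A.V`; the trace does not depend on which dual is used. -/
theorem trace_hom {C : Type u} [Category.{v} C] [MonoidalCategory C] [SymmetricCategory C]
    [RightRigidCategory C] {G : Type*} [Group G] {A : Action C G} (f : A ⟶ A) :
    (trace f : 𝟙_ (Action C G) ⟶ 𝟙_ (Action C G)).hom = trace f.hom := by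
  let P : ExactPairing A.V (HasRightDual.rightDual A).V :=
    { coevaluation' := (η_ A (HasRightDual.rightDual A)).hom
      evaluation' := (ε_ A (HasRightDual.rightDual A)).hom
      coevaluation_evaluation' := by
        have h := congrArg Action.Hom.hom
          (ExactPairing.coevaluation_evaluation A (HasRightDual.rightDual A))
        simp only [Action.comp_hom, Action.whiskerLeft_hom, Action.whiskerRight_hom,
          Action.associator_inv_hom, Action.leftUnitor_inv_hom, Action.rightUnitor_hom_hom] at h
        exact h
      evaluation_coevaluation' := by
        have h := congrArg Action.Hom.hom
          (ExactPairing.evaluation_coevaluation A (HasRightDual.rightDual A))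
        simp only [Action.comp_hom, Action.whiskerLeft_hom, Action.whiskerRight_hom,
          Action.associator_hom_hom, Action.leftUnitor_hom_hom, Action.rightUnitor_inv_hom] at h
        exact h }
  rw [trace_congr_dual inferInstance (HasRightDual.mk (HasRightDual.rightDual A).V) f.hom]
  rfl

/-! ### Direct sum decompositions -/

/-- The morphisms `i` and `q` exhibit `Z` as the direct sum of the objects `S l`. -/
structure IsDirectSum {C : Type u} [Category.{v} C] [Preadditive C] {ι : Type*} [Fintype ι] (Z : C)
    (S : ι → C) (i : ∀ l, S l ⟶ Z) (q : ∀ l, Z ⟶ S l) : Prop where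
  self : ∀ l, i l ≫ q l = 𝟙 _
  ne : ∀ l m, l ≠ m → i l ≫ q m = 0
  total : ∑ l, q l ≫ i l = 𝟙 Z

section DirectSum

variable {C : Type u} [Category.{v} C] [Preadditive C] {ι : Type*} [Fintype ι] {Z : C} {S : ι → C}
  {i : ∀ l, S l ⟶ Z} {q : ∀ l, Z ⟶ S l}

theorem isDirectSum_biproduct [HasFiniteBiproducts C] {ι : Type} [Fintype ι] (S : ι → C) :
    IsDirectSum (⨁ S) S (biproduct.ι S) (biproduct.π S) where
  self := biproduct.ι_π_self S
  ne _ _ h := biproduct.ι_π_ne S h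
  total := biproduct.total

theorem IsDirectSum.congr_iso (h : IsDirectSum Z S i q) {Z' : C} (e : Z ≅ Z') :
    IsDirectSum Z' S (fun l => i l ≫ e.hom) (fun l => e.inv ≫ q l) where
  self l := by simp [h.self]
  ne l m hlm := by simp [h.ne l m hlm]
  total := by
    have : ∀ l, (e.inv ≫ q l) ≫ i l ≫ e.hom = e.inv ≫ (q l ≫ i l) ≫ e.hom := by simp
    simp only [this]
    rw [← Preadditive.comp_sum, ← Preadditive.sum_comp, h.total]
    simp

theorem IsDirectSum.map (h : IsDirectSum Z S i q) {D : Type*} [Category* D] [Preadditive D]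
    (F : C ⥤ D) [F.Additive] :
    IsDirectSum (F.obj Z) (fun l => F.obj (S l)) (fun l => F.map (i l)) (fun l => F.map (q l)) where
  self l := by simp [← F.map_comp, h.self]
  ne l m hlm := by simp [← F.map_comp, h.ne l m hlm]
  total := by
    simp only [← F.map_comp]
    rw [← F.map_sum, h.total, F.map_id]

theorem isDirectSum_of_iso {Z Y : C} (e : Y ≅ Z) :
    IsDirectSum Z (fun _ : Fin 1 => Y) (fun _ => e.hom) (fun _ => e.inv) where
  self l := by simp
  ne l m hlm := (hlm (Subsingleton.elim _ _)).elim
  total := by simp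

variable {k : Type w} [Field k] [Linear k C]

/-- Morphisms into a direct sum are families of morphisms into the summands. -/
def IsDirectSum.homEquiv (h : IsDirectSum Z S i q) (A : C) : (A ⟶ Z) ≃ₗ[k] (∀ l, A ⟶ S l) where
  toFun f l := f ≫ q l
  map_add' f g := by ext l; simp
  map_smul' c f := by ext l; simp
  invFun f := ∑ l, f l ≫ i l
  left_inv f := by simp [← Preadditive.comp_sum, h.total]
  right_inv f := by
    ext l
    change (∑ l, f l ≫ i l) ≫ q l = f l
    rw [Preadditive.sum_comp, Finset.sum_eq_single l]
    · simp [h.self]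
    · intro m _ hm; simp [h.ne m l hm]
    · simp

/-- Morphisms from a direct sum are families of morphisms from the summands. -/
def IsDirectSum.homEquiv' (h : IsDirectSum Z S i q) (A : C) : (Z ⟶ A) ≃ₗ[k] (∀ l, S l ⟶ A) where
  toFun f l := i l ≫ f
  map_add' f g := by ext l; simp
  map_smul' c f := by ext l; simp
  invFun f := ∑ l, q l ≫ f l
  left_inv f := by simp only [← Category.assoc, ← Preadditive.sum_comp, h.total, Category.id_comp]
  right_inv f := by
    ext l
    change i l ≫ (∑ l, q l ≫ f l) = f l
    rw [Preadditive.comp_sum, Finset.sum_eq_single l]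
    · simp [reassoc_of% h.self]
    · intro m _ hm; simp [reassoc_of% h.ne l m hm.symm]
    · simp

theorem IsDirectSum.finrank_hom (hfin : ∀ X Y : C, Module.Finite k (X ⟶ Y))
    (h : IsDirectSum Z S i q) (A : C) :
    Module.finrank k (A ⟶ Z) = ∑ l, Module.finrank k (A ⟶ S l) := by
  rw [(h.homEquiv (k := k) A).finrank_eq, Module.finrank_pi_fintype]

theorem IsDirectSum.finrank_hom' (hfin : ∀ X Y : C, Module.Finite k (X ⟶ Y))
    (h : IsDirectSum Z S i q) (A : C) :
    Module.finrank k (Z ⟶ A) = ∑ l, Module.finrank k (S l ⟶ A) := by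
  rw [(h.homEquiv' (k := k) A).finrank_eq, Module.finrank_pi_fintype]

end DirectSum

/-! ### Scalar traces and multiplicities in a symmetric fusion category -/

section Scalars

variable (k : Type w) [Field k] [IsAlgClosed k] {C : Type u} [Category.{v} C] [Abelian C]
  [Linear k C] [MonoidalCategory C] [IsFusion k C]

include k in
theorem exists_isDirectSum (X : C) : ∃ (n : ℕ) (S : Fin n → C) (i : ∀ l, S l ⟶ X)
    (q : ∀ l, X ⟶ S l), (∀ l, Simple (S l)) ∧ IsDirectSum X S i q := by
  obtain ⟨n, S, hS, ⟨e⟩⟩ := IsFusion.semisimple (k := k) X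
  exact ⟨n, S, _, _, hS, (isDirectSum_biproduct S).congr_iso e.symm⟩

theorem exists_smul_id {X : C} [Simple X] (f : X ⟶ X) : ∃ c : k, c • 𝟙 X = f :=
  have := IsFusion.finite_hom (k := k) X X
  endomorphism_simple_eq_smul_id k f

theorem smul_id_injective {X : C} [Simple X] : Function.Injective fun c : k => c • 𝟙 X :=
  smul_left_injective k (id_nonzero X)

/-- The scalar by which an endomorphism of a simple object acts. -/
def scalar {X : C} [Simple X] (f : X ⟶ X) : k := (exists_smul_id k f).choose

theorem scalar_smul_id {X : C} [Simple X] (f : X ⟶ X) : scalar k f • 𝟙 X = f :=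
  (exists_smul_id k f).choose_spec

theorem scalar_eq_iff {X : C} [Simple X] {f : X ⟶ X} {c : k} : scalar k f = c ↔ f = c • 𝟙 X :=
  ⟨fun h => by rw [← h, scalar_smul_id], fun h => smul_id_injective k (X := X) (by
    simp only [scalar_smul_id, h])⟩

variable [MonoidalPreadditive C] [MonoidalLinear k C] [SymmetricCategory C] [RightRigidCategory C]

/-- The trace as an element of `k`. -/
def tr {X : C} (f : X ⟶ X) : k :=
  have : Simple (𝟙_ C) := IsFusion.simple_unit k
  scalar k (trace f : 𝟙_ C ⟶ 𝟙_ C)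

/-- The dimension as an element of `k`. -/
def sdim (X : C) : k := tr k (𝟙 X)

theorem tr_eq_iff {X : C} {f : X ⟶ X} {c : k} : tr k f = c ↔ trace f = c • 𝟙 (𝟙_ C) :=
  have : Simple (𝟙_ C) := IsFusion.simple_unit k
  scalar_eq_iff k

theorem trace_eq {X : C} (f : X ⟶ X) : trace f = tr k f • 𝟙 (𝟙_ C) := (tr_eq_iff k).1 rfl

theorem tr_zero {X : C} : tr k (0 : X ⟶ X) = 0 := by
  rw [tr_eq_iff, trace_zero, zero_smul]

theorem tr_sub {X : C} (f g : X ⟶ X) : tr k (f - g) = tr k f - tr k g := by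
  rw [tr_eq_iff, trace_sub, trace_eq k f, trace_eq k g, sub_smul]

theorem tr_sum {ι : Type*} (s : Finset ι) {X : C} (f : ι → (X ⟶ X)) :
    tr k (∑ i ∈ s, f i) = ∑ i ∈ s, tr k (f i) := by
  rw [tr_eq_iff, trace_sum, Finset.sum_smul]
  simp only [trace_eq k]

theorem tr_smul {X : C} (c : k) (f : X ⟶ X) : tr k (c • f) = c * tr k f := by
  rw [tr_eq_iff, trace_smul, trace_eq k f, smul_smul]

theorem tr_comp_comm {X Y : C} (f : X ⟶ Y) (g : Y ⟶ X) : tr k (f ≫ g) = tr k (g ≫ f) := by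
  rw [tr_eq_iff, trace_comp_comm, trace_eq k]

theorem sdim_unit : sdim k (𝟙_ C) = 1 := by
  rw [sdim, tr_eq_iff, one_smul]
  exact @trace_unit C _ _ _ (RightRigidCategory.rightDual _) (𝟙 _)

theorem sdim_tensor (X Y : C) : sdim k (X ⊗ Y) = sdim k X * sdim k Y := by
  have h := dim_tensor X Y
  simp only [dim, trace_eq k] at h
  rw [sdim, tr_eq_iff, trace_eq k, h]
  simp [smul_smul, sdim, mul_comm]

theorem sdim_rightDual (X : C) : sdim k (Xᘁ) = sdim k X := by
  rw [sdim, tr_eq_iff]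
  exact (dim_rightDual X).trans (trace_eq k _)

theorem sdim_tensorPow (X : C) (n : ℕ) : sdim k (tensorPow X n) = sdim k X ^ n := by
  induction n with
  | zero => simp [tensorPow, sdim_unit]
  | succ n ih => rw [tensorPow, sdim_tensor, ih, pow_succ']

variable {k}

theorem IsDirectSum.tr_eq {ι : Type*} [Fintype ι] {Z : C} {S : ι → C} {i : ∀ l, S l ⟶ Z}
    {q : ∀ l, Z ⟶ S l} (h : IsDirectSum Z S i q) (f : Z ⟶ Z) :
    tr k f = ∑ l, tr k (i l ≫ f ≫ q l) := by
  conv_lhs => rw [← Category.comp_id f, ← h.total, Preadditive.comp_sum, tr_sum]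
  refine Finset.sum_congr rfl fun l _ => ?_
  rw [← Category.assoc, tr_comp_comm]

theorem IsDirectSum.sdim_eq {ι : Type*} [Fintype ι] {Z : C} {S : ι → C} {i : ∀ l, S l ⟶ Z}
    {q : ∀ l, Z ⟶ S l} (h : IsDirectSum Z S i q) : sdim k Z = ∑ l, sdim k (S l) := by
  rw [sdim, h.tr_eq]
  simp [h.self, sdim]

theorem sdim_eq_of_iso {X Y : C} (e : X ≅ Y) : sdim k X = sdim k Y := by
  simpa using ((isDirectSum_of_iso e).sdim_eq (k := k)).symm

end Scalars

/-! ### The operators of tensor multiplication -/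

section Multiplicity

variable (k : Type w) [Field k] [IsAlgClosed k] (C : Type u) [Category.{v} C] [Abelian C]
  [Linear k C] [MonoidalCategory C] [IsFusion k C]

/-- The isomorphism classes of simple objects. -/
abbrev Irr (C : Type u) [Category.{v} C] [Abelian C] :=
  {X : Skeleton C // Simple ((fromSkeleton C).obj X)}

variable {C}

/-- A representative of an isomorphism class of simple objects. -/
abbrev Irr.obj (i : Irr C) : C := (fromSkeleton C).obj i.1

instance (i : Irr C) : Simple i.obj := i.2

variable (C) in
include k in
theorem finite_irr : Finite (Irr C) := IsFusion.finite_simple k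

omit [IsAlgClosed k] [Linear k C] [MonoidalCategory C] [IsFusion k C] in
theorem exists_irr_iso (X : C) [Simple X] : ∃ i : Irr C, Nonempty (i.obj ≅ X) :=
  let e := fromSkeletonToSkeletonIso X
  ⟨⟨toSkeleton X, Simple.of_iso e⟩, ⟨e⟩⟩

theorem irr_eq_of_iso {i j : Irr C} (e : i.obj ≅ j.obj) : i = j := by
  apply Subtype.ext
  have := toSkeleton_eq_toSkeleton_iff.2 ⟨e⟩
  rwa [toSkeleton_fromSkeleton_obj, toSkeleton_fromSkeleton_obj] at this

/-- The dimension of the space of morphisms. -/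
abbrev homDim (X Y : C) : ℕ := Module.finrank k (X ⟶ Y)

variable {k}

open Classical in
theorem homDim_simple (X Y : C) [Simple X] [Simple Y] :
    homDim k X Y = if Nonempty (X ≅ Y) then 1 else 0 :=
  have := IsFusion.finite_hom (k := k) (C := C)
  finrank_hom_simple_simple k X Y

theorem homDim_congr_left {X Y : C} (e : X ≅ Y) (Z : C) : homDim k X Z = homDim k Y Z :=
  (Linear.homCongr k e (Iso.refl Z)).finrank_eq

theorem homDim_congr_right {X Y : C} (e : X ≅ Y) (Z : C) : homDim k Z X = homDim k Z Y :=
  (Linear.homCongr k (Iso.refl Z) e).finrank_eq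

theorem homDim_symm_of_simple (X Y : C) [Simple X] : homDim k X Y = homDim k Y X := by
  obtain ⟨n, S, i, q, hS, h⟩ := exists_isDirectSum k Y
  have hf := IsFusion.finite_hom (k := k) (C := C)
  unfold homDim
  rw [h.finrank_hom hf, h.finrank_hom' hf]
  refine Finset.sum_congr rfl fun l _ => ?_
  have := hS l
  change homDim k _ _ = homDim k _ _
  rw [homDim_simple, homDim_simple]
  have : Nonempty (X ≅ S l) ↔ Nonempty (S l ≅ X) := ⟨fun ⟨e⟩ => ⟨e.symm⟩, fun ⟨e⟩ => ⟨e.symm⟩⟩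
  classical exact if_congr this rfl rfl

/-- A function on objects that is additive on direct sums is determined by its values on simple
objects. -/
theorem eq_sum_homDim_mul [Fintype (Irr C)] {R : Type*} [Semiring R] (φ : C → R)
    (hφ : ∀ (n : ℕ) (Z : C) (S : Fin n → C) (i : ∀ l, S l ⟶ Z) (q : ∀ l, Z ⟶ S l),
      IsDirectSum Z S i q → φ Z = ∑ l, φ (S l)) (Z : C) :
    φ Z = ∑ i : Irr C, (homDim k i.obj Z : R) * φ i.obj := by
  obtain ⟨n, S, i, q, hS, h⟩ := exists_isDirectSum k Z
  rw [hφ n Z S i q h]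
  have hf := IsFusion.finite_hom (k := k) (C := C)
  have h1 : ∀ j : Irr C, homDim k j.obj Z = ∑ l, homDim k j.obj (S l) :=
    fun j => h.finrank_hom hf _
  simp only [h1, Nat.cast_sum, Finset.sum_mul]
  rw [Finset.sum_comm]
  refine Finset.sum_congr rfl fun l _ => ?_
  have := hS l
  obtain ⟨j, ⟨e⟩⟩ := exists_irr_iso (S l)
  rw [Finset.sum_eq_single j]
  · rw [homDim_simple, if_pos ⟨e⟩, hφ 1 _ _ _ _ (isDirectSum_of_iso e)]
    simp
  · intro m _ hm
    rw [homDim_simple, if_neg]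
    · simp
    · rintro ⟨e'⟩
      exact hm (irr_eq_of_iso (e' ≪≫ e.symm))
  · simp

variable [MonoidalPreadditive C] [MonoidalLinear k C]

theorem homDim_tensor_right (X Y Y' Z : C) [ExactPairing Y Y'] :
    homDim k (X ⊗ Y) Z = homDim k X (Z ⊗ Y') := by
  refine LinearEquiv.finrank_eq
    { tensorRightHomEquiv X Y Y' Z with
      map_add' := fun f g => ?_
      map_smul' := fun c f => ?_ }
  · simp [tensorRightHomEquiv, MonoidalPreadditive.add_whiskerRight]
  · simp [tensorRightHomEquiv]

variable [SymmetricCategory C] [RightRigidCategory C]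

theorem homDim_tensor_left_additive (A X : C) (n : ℕ) (Z : C) (S : Fin n → C) (i : ∀ l, S l ⟶ Z)
    (q : ∀ l, Z ⟶ S l) (h : IsDirectSum Z S i q) :
    (homDim k A (X ⊗ Z) : k) = ∑ l, (homDim k A (X ⊗ S l) : k) := by
  rw [← Nat.cast_sum]
  exact congrArg _ ((h.map (tensorLeft X)).finrank_hom (IsFusion.finite_hom (k := k) (C := C)) A)

variable (k) in
/-- The matrix, over `k`, of tensor multiplication by `X` in the Grothendieck group. -/
def mulMatrix (X : C) : Matrix (Irr C) (Irr C) k :=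
  Matrix.of fun a b => (homDim k a.obj (X ⊗ b.obj) : k)

theorem mulMatrix_congr {X Y : C} (e : X ≅ Y) : mulMatrix k X = mulMatrix k Y := by
  ext a b
  simp only [mulMatrix, Matrix.of_apply]
  rw [homDim_congr_right (whiskerRightIso e b.obj)]

theorem mulMatrix_unit [DecidableEq (Irr C)] : mulMatrix k (𝟙_ C) = 1 := by
  ext a b
  simp only [mulMatrix, Matrix.of_apply]
  rw [homDim_congr_right (λ_ b.obj), homDim_simple, Matrix.one_apply]
  have : Nonempty (a.obj ≅ b.obj) ↔ a = b :=
    ⟨fun ⟨e⟩ => irr_eq_of_iso e, fun h => h ▸ ⟨Iso.refl _⟩⟩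
  simp [this]

variable [Fintype (Irr C)]

/-- Matrix multiplication here is the expansion of the additive function `Z ↦ homDim k a.obj (X ⊗
Z)` over the simple constituents of `Y ⊗ b`. -/
theorem mulMatrix_tensor (X Y : C) : mulMatrix k (X ⊗ Y) = mulMatrix k X * mulMatrix k Y := by
  ext a b
  simp only [mulMatrix, Matrix.of_apply, Matrix.mul_apply]
  rw [homDim_congr_right (α_ X Y b.obj),
    eq_sum_homDim_mul (k := k) (fun Z => (homDim k a.obj (X ⊗ Z) : k))
      (homDim_tensor_left_additive a.obj X)]
  exact Finset.sum_congr rfl fun i _ => mul_comm _ _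

theorem mulMatrix_commute (X Y : C) : Commute (mulMatrix k X) (mulMatrix k Y) := by
  rw [Commute, SemiconjBy, ← mulMatrix_tensor, ← mulMatrix_tensor, mulMatrix_congr (β_ X Y)]

theorem mulMatrix_tensorPow [DecidableEq (Irr C)] (X : C) (n : ℕ) :
    mulMatrix k (tensorPow X n) = mulMatrix k X ^ n := by
  induction n with
  | zero => rw [tensorPow, mulMatrix_unit, pow_zero]
  | succ n ih => rw [tensorPow, mulMatrix_tensor, ih, pow_succ']

/-- The sum of the simple objects weighted by their dimensions acts by a matrix of rank one. -/
theorem sum_sdim_smul_mulMatrix (a b : Irr C) :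
    (∑ i : Irr C, sdim k i.obj • mulMatrix k i.obj) a b = sdim k a.obj * sdim k b.obj := by
  -- By duality `[i ⊗ b : a] = [a ⊗ bᘁ : i]`, so the weighted sum over `i` is the expansion of
  -- `dim(a ⊗ bᘁ)` into simple constituents.
  have h : ∀ i : Irr C, homDim k a.obj (i.obj ⊗ b.obj) = homDim k i.obj (a.obj ⊗ (b.obj)ᘁ) := by
    intro i
    let _ : ExactPairing (HasRightDual.rightDual b.obj) b.obj :=
      BraidedCategory.exactPairing_swap _ _
    rw [← homDim_tensor_right a.obj (HasRightDual.rightDual b.obj) b.obj i.obj,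
      homDim_symm_of_simple i.obj]
  rw [Matrix.sum_apply, ← sdim_rightDual k b.obj, ← sdim_tensor,
    eq_sum_homDim_mul (k := k) (sdim k) (fun n Z S i q h => h.sdim_eq)]
  refine Finset.sum_congr rfl fun i _ => ?_
  simp only [Matrix.smul_apply, mulMatrix, Matrix.of_apply, smul_eq_mul, h]
  exact mul_comm _ _

/-- Additivity of the `p`-th power in characteristic `p`, available because the matrices commute. -/
theorem sum_smul_mulMatrix_pow_char (p : ℕ) [Fact p.Prime] [CharP k p] [DecidableEq (Irr C)]
    (s : Finset (Irr C)) (c : Irr C → k) :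
    (∑ i ∈ s, c i • mulMatrix k i.obj) ^ p = ∑ i ∈ s, c i ^ p • mulMatrix k i.obj ^ p := by
  have : Simple (𝟙_ C) := IsFusion.simple_unit k
  obtain ⟨i₀, -⟩ := exists_irr_iso (C := C) (𝟙_ C)
  -- Matrices over an empty index set form the zero ring, which does not have characteristic `p`.
  have : Nonempty (Irr C) := ⟨i₀⟩
  induction s using Finset.cons_induction with
  | empty => simp [(Fact.out : p.Prime).ne_zero]
  | cons a s ha ih =>
    rw [Finset.sum_cons, Finset.sum_cons, ← ih, add_pow_char_of_commute (p := p), smul_pow]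
    exact Commute.sum_right _ _ _ fun i _ =>
      ((mulMatrix_commute _ _).smul_left _).smul_right _

theorem globalDim_eq : globalDim C = (∑ i : Irr C, sdim k i.obj ^ 2) • 𝟙 (𝟙_ C) := by
  rw [globalDim, finsum_eq_sum_of_fintype, Finset.sum_smul]
  refine Finset.sum_congr rfl fun i _ => ?_
  rw [dim, trace_eq k, pow_two, pow_two, End.mul_def]
  simp [smul_smul, sdim]

/-- If the dimension of `C` vanishes, then so does the multiplicity of the unit object in the
`p`-th power of the sum of the simple objects weighted by their dimensions. -/
theorem sum_sdim_tensorPow_mul_homDim_eq_zero (p : ℕ) [Fact p.Prime] [CharP k p]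
    (h : globalDim C = 0) :
    ∑ i : Irr C, sdim k (tensorPow i.obj p) * (homDim k (𝟙_ C) (tensorPow i.obj p) : k) = 0 := by
  classical
  have hs : Simple (𝟙_ C) := IsFusion.simple_unit k
  obtain ⟨i₀, ⟨e⟩⟩ := exists_irr_iso (𝟙_ C)
  have h0 : ∑ i : Irr C, sdim k i.obj ^ 2 = 0 := by
    rw [globalDim_eq (k := k)] at h
    exact (smul_eq_zero.1 h).resolve_right (id_nonzero _)
  have hU := sum_smul_mulMatrix_pow_char (k := k) p (Finset.univ : Finset (Irr C))
    (fun i => sdim k i.obj)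
  -- For the rank one matrix `U = (d_a d_b)` one has `U² = (∑ d_x²) U`.
  have hsq : (∑ i : Irr C, sdim k i.obj • mulMatrix k i.obj) ^ 2 = 0 := by
    ext a b
    rw [pow_two, Matrix.mul_apply]
    simp only [sum_sdim_smul_mulMatrix]
    have : ∀ x : Irr C, sdim k a.obj * sdim k x.obj * (sdim k x.obj * sdim k b.obj) =
        (sdim k a.obj * sdim k b.obj) * sdim k x.obj ^ 2 := fun x => by ring
    simp only [this]
    rw [← Finset.mul_sum, h0, mul_zero, Matrix.zero_apply]
  rw [pow_eq_zero_of_le (Fact.out : p.Prime).two_le hsq] at hU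
  -- The diagonal entry at the unit object records the multiplicity of `𝟙` in each `X^{⊗p}`.
  have := congrFun (congrFun hU.symm i₀) i₀
  rw [Matrix.sum_apply, Matrix.zero_apply] at this
  rw [← this]
  refine Finset.sum_congr rfl fun i _ => ?_
  rw [Matrix.smul_apply, ← mulMatrix_tensorPow, smul_eq_mul, sdim_tensorPow]
  simp only [mulMatrix, Matrix.of_apply]
  rw [homDim_congr_right (whiskerLeftIso _ e ≪≫ ρ_ _), homDim_congr_left e]

end Multiplicity

/-! ### The isotypic projection onto the unit object -/

section UnitProjection

variable (k : Type w) [Field k] [IsAlgClosed k] {C : Type u} [Category.{v} C] [Abelian C]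
  [Linear k C] [MonoidalCategory C] [IsFusion k C]

include k in
theorem hom_ext_simple {A B : C} {f g : A ⟶ B}
    (h : ∀ (S : C) (_ : Simple S) (i : S ⟶ A), i ≫ f = i ≫ g) : f = g := by
  obtain ⟨n, S, i, q, hS, hA⟩ := exists_isDirectSum k A
  rw [← Category.id_comp f, ← Category.id_comp g, ← hA.total, Preadditive.sum_comp,
    Preadditive.sum_comp]
  exact Finset.sum_congr rfl fun l _ => by rw [Category.assoc, Category.assoc, h _ (hS l)]

open Classical in
include k in
-- Characterising the projection by its effect on all maps from simple objects, not by a chosen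
-- decomposition, makes it unique and hence natural in `A`.
theorem exists_unitProj (A : C) : ∃ f : A ⟶ A, ∀ (S : C) (_ : Simple S) (i : S ⟶ A),
    i ≫ f = if Nonempty (S ≅ 𝟙_ C) then i else 0 := by
  obtain ⟨n, S, i, q, hS, hA⟩ := exists_isDirectSum k A
  refine ⟨∑ l, if Nonempty (S l ≅ 𝟙_ C) then q l ≫ i l else 0, fun T hT j => ?_⟩
  -- By Schur's lemma a nonzero component `T ⟶ S l` is an isomorphism, so the condition on `S l` can
  -- be replaced by the same condition on `T`.
  have key : ∀ l, (j ≫ if Nonempty (S l ≅ 𝟙_ C) then q l ≫ i l else 0) =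
      if Nonempty (T ≅ 𝟙_ C) then j ≫ q l ≫ i l else 0 := by
    intro l
    have := hS l
    by_cases hj : j ≫ q l = 0
    · have h0 : j ≫ q l ≫ i l = 0 := by rw [← Category.assoc, hj, zero_comp]
      split_ifs <;> simp [h0]
    · have := isIso_of_hom_simple hj
      have e := asIso (j ≫ q l)
      have : Nonempty (S l ≅ 𝟙_ C) ↔ Nonempty (T ≅ 𝟙_ C) :=
        ⟨fun ⟨a⟩ => ⟨e ≪≫ a⟩, fun ⟨a⟩ => ⟨e.symm ≪≫ a⟩⟩
      simp only [this]
      split_ifs <;> simp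
  rw [Preadditive.comp_sum, Finset.sum_congr rfl fun l _ => key l]
  split_ifs
  · rw [← Preadditive.comp_sum, hA.total, Category.comp_id]
  · simp

variable (C) in
/-- The natural projection of every object onto its isotypic component of type the unit object. -/
def unitProj : 𝟭 C ⟶ 𝟭 C where
  app A := (exists_unitProj k A).choose
  naturality A B f := hom_ext_simple k fun S hS i => by
    have h1 := (exists_unitProj k A).choose_spec S hS i
    have h2 := (exists_unitProj k B).choose_spec S hS (i ≫ f)
    simp only [Functor.id_map, Functor.id_obj]
    rw [← Category.assoc, h2, ← Category.assoc, h1]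
    split_ifs <;> simp

open Classical in
theorem unitProj_app_simple (S : C) [Simple S] :
    (unitProj k C).app S = if Nonempty (S ≅ 𝟙_ C) then 𝟙 S else 0 := by
  have := (exists_unitProj k S).choose_spec S inferInstance (𝟙 S)
  rwa [Category.id_comp] at this

variable [MonoidalPreadditive C] [MonoidalLinear k C] [SymmetricCategory C] [RightRigidCategory C]

theorem tr_unitProj_of_simple (S : C) [Simple S] :
    tr k ((unitProj k C).app S) = homDim k (𝟙_ C) S := by
  have : Simple (𝟙_ C) := IsFusion.simple_unit k
  rw [unitProj_app_simple, homDim_simple]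
  by_cases h : Nonempty (S ≅ 𝟙_ C)
  · obtain ⟨e⟩ := h
    rw [if_pos ⟨e⟩, if_pos ⟨e.symm⟩]
    exact (sdim_eq_of_iso e).trans (by rw [sdim_unit, Nat.cast_one])
  · rw [if_neg h, if_neg fun ⟨e⟩ => h ⟨e.symm⟩]
    exact (tr_zero k).trans Nat.cast_zero.symm

/-- Each copy of the unit contributes `dim 𝟙 = 1`. This expresses a multiplicity, mod `p`, as a
trace against a natural endomorphism, which negligible morphisms cannot change. -/
theorem tr_unitProj (A : C) : tr k ((unitProj k C).app A) = homDim k (𝟙_ C) A := by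
  obtain ⟨n, S, i, q, hS, hA⟩ := exists_isDirectSum k A
  have h1 := hA.tr_eq (k := k) ((unitProj k C).app A)
  rw [homDim, hA.finrank_hom (IsFusion.finite_hom (k := k) (C := C)), Nat.cast_sum]
  refine h1.trans (Finset.sum_congr rfl fun l _ => ?_)
  have := hS l
  rw [← tr_unitProj_of_simple]
  congr 1
  have h2 := (unitProj k C).naturality (i l)
  simp only [Functor.id_map, Functor.id_obj] at h2 ⊢
  rw [← Category.assoc, h2, Category.assoc, hA.self]
  exact Category.comp_id _

/-- The trace of a negligible endomorphism against a natural endomorphism of the identity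
functor vanishes. -/
theorem Negligible.tr_eq_zero {G : Type*} [Group G] {A : Action C G} {f : A ⟶ A}
    (hf : Negligible f) (e : 𝟭 C ⟶ 𝟭 C) : tr k (e.app A.V ≫ f.hom) = 0 := by
  -- Naturality of `e` makes its component at `A.V` equivariant, hence a legitimate test morphism
  -- for negligibility.
  let u : A ⟶ A := ⟨e.app A.V, fun g => e.naturality (A.ρ g)⟩
  have h := congrArg Action.Hom.hom (hf u)
  have h2 := (trace_hom (u ≫ f)).symm.trans h
  rw [tr_eq_iff, zero_smul]
  exact h2

end UnitProjection

/-! ### Traces of representations -/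

theorem hom_unit_eq_smul_id {k : Type w} [Field k]
    (f : 𝟙_ (FGModuleCat.{w} k) ⟶ 𝟙_ (FGModuleCat k)) :
    f = (f.hom.hom (1 : k) : k) • 𝟙 (𝟙_ (FGModuleCat k)) := by
  apply FGModuleCat.hom_ext
  refine LinearMap.ext fun (x : k) => ?_
  have h := f.hom.hom.map_smul x (1 : k)
  have hx : (x • (1 : k)) = x := mul_one x
  have h' : f.hom.hom (x • (1 : k)) = (x * f.hom.hom (1 : k) : k) := h
  rw [hx] at h'
  exact h'.trans (mul_comm _ _)

/-- The categorical trace of an endomorphism of a finite dimensional vector space is its trace. -/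
theorem trace_fgModuleCat {k : Type w} [Field k] {V : FGModuleCat.{w} k} (f : V ⟶ V) :
    trace f = LinearMap.trace k V f.hom.hom • 𝟙 (𝟙_ (FGModuleCat k)) := by
  let b := Module.finBasis k V
  let i : ∀ _ : Fin (Module.finrank k V), 𝟙_ (FGModuleCat k) ⟶ V :=
    fun j => FGModuleCat.ofHom (LinearMap.toSpanSingleton k V (b j))
  let q : ∀ _ : Fin (Module.finrank k V), V ⟶ 𝟙_ (FGModuleCat k) :=
    fun j => FGModuleCat.ofHom (b.coord j)
  have total : ∑ j, q j ≫ i j = 𝟙 V := by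
    apply (forget₂ (FGModuleCat k) (ModuleCat k)).map_injective
    rw [Functor.map_sum]
    apply ModuleCat.hom_ext
    rw [ModuleCat.hom_sum]
    ext x
    rw [LinearMap.sum_apply]
    exact b.sum_repr x
  -- A basis writes the identity as a sum of maps through the unit; cyclicity turns each term into
  -- the trace of an endomorphism of the unit, a diagonal entry of `f`.
  conv_lhs => rw [← Category.comp_id f, ← total, Preadditive.comp_sum, trace_sum]
  rw [LinearMap.trace_eq_matrix_trace k b, Matrix.trace, Finset.sum_smul]
  refine Finset.sum_congr rfl fun j _ => ?_
  rw [← Category.assoc, trace_comp_comm]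
  refine (trace_unit _).trans ?_
  rw [hom_unit_eq_smul_id (i j ≫ f ≫ q j)]
  congr 1
  rw [Matrix.diag_apply, LinearMap.toMatrix_apply]
  change b.repr (f.hom.hom ((1 : k) • b j)) j = b.repr (f.hom.hom (b j)) j
  rw [one_smul]

theorem Negligible.linearMap_trace_eq_zero {k : Type w} [Field k] {G : Type*} [Group G]
    {V W : FDRep k G} {f : V ⟶ W} (hf : Negligible f) (u : W ⟶ V) :
    LinearMap.trace k W.V (u ≫ f).hom.hom.hom = 0 := by
  have h := (trace_hom (u ≫ f)).symm.trans (congrArg Action.Hom.hom (hf u))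
  have h2 := (trace_fgModuleCat _).symm.trans h
  have h3 := congrArg (fun g => g.hom.hom (1 : k)) h2
  have h4 : LinearMap.trace k W.V (u ≫ f).hom.hom.hom * (1 : k) = 0 := h3
  rwa [mul_one] at h4

/-! ### Tensoring a simple object with a multiplicity space -/

section Box

theorem IsDirectSum.congr_summands {C : Type u} [Category.{v} C] [Preadditive C] {ι : Type*}
    [Fintype ι] {Z : C} {S S' : ι → C} {i : ∀ l, S l ⟶ Z} {q : ∀ l, Z ⟶ S l}
    (h : IsDirectSum Z S i q) (e : ∀ l, S l ≅ S' l) :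
    IsDirectSum Z S' (fun l => (e l).inv ≫ i l) (fun l => q l ≫ (e l).hom) where
  self l := by simp [reassoc_of% h.self]
  ne l m hlm := by simp [reassoc_of% h.ne l m hlm]
  total := by simp [h.total]

variable {k : Type w} [Field k] {C : Type u} [Category.{v} C] [Abelian C]
  [Linear k C] [MonoidalCategory C]

/-- The inclusion of a copy of `Y` into `Y ⊗ (V ⊗ 𝟙)`. -/
def boxι (Y : C) (V : FGModuleCat.{w} k) (l : Fin (Module.finrank k V)) :
    Y ⟶ Y ⊗ (vecTensor k C).obj V :=
  (ρ_ Y).inv ≫ Y ◁ biproduct.ι (fun _ : Fin (Module.finrank k V) => 𝟙_ C) l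

/-- The projection of `Y ⊗ (V ⊗ 𝟙)` onto a copy of `Y`. -/
def boxπ (Y : C) (V : FGModuleCat.{w} k) (l : Fin (Module.finrank k V)) :
    Y ⊗ (vecTensor k C).obj V ⟶ Y :=
  Y ◁ biproduct.π (fun _ : Fin (Module.finrank k V) => 𝟙_ C) l ≫ (ρ_ Y).hom

variable [MonoidalPreadditive C]

theorem isDirectSum_box (Y : C) (V : FGModuleCat.{w} k) :
    IsDirectSum (Y ⊗ (vecTensor k C).obj V) (fun _ => Y) (boxι Y V) (boxπ Y V) :=
  ((isDirectSum_biproduct (fun _ : Fin (Module.finrank k V) => 𝟙_ C)).map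
    (tensorLeft Y)).congr_summands fun _ => ρ_ Y

variable [MonoidalLinear k C]

theorem boxι_map_boxπ (Y : C) {V W : FGModuleCat.{w} k} (f : V ⟶ W) (l m) :
    boxι Y V l ≫ Y ◁ (vecTensor k C).map f ≫ boxπ Y W m =
      LinearMap.toMatrix (Module.finBasis k V) (Module.finBasis k W) f.hom.hom m l • 𝟙 Y := by
  have h : biproduct.ι (fun _ : Fin (Module.finrank k V) => 𝟙_ C) l ≫ (vecTensor k C).map f ≫
      biproduct.π (fun _ : Fin (Module.finrank k W) => 𝟙_ C) m =
      LinearMap.toMatrix (Module.finBasis k V) (Module.finBasis k W) f.hom.hom m l •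
        𝟙 (𝟙_ C) := by
    simp [vecTensor]
  have key : ∀ {A B : C} (a : 𝟙_ C ⟶ A) (t : A ⟶ B) (b : B ⟶ 𝟙_ C) (c : k),
      a ≫ t ≫ b = c • 𝟙 (𝟙_ C) →
      ((ρ_ Y).inv ≫ Y ◁ a) ≫ Y ◁ t ≫ Y ◁ b ≫ (ρ_ Y).hom = c • 𝟙 Y := by
    intro A B a t b c h
    have h2 := congrArg (fun t => (ρ_ Y).inv ≫ Y ◁ t ≫ (ρ_ Y).hom) h
    simpa using h2
  exact key _ _ _ _ h

theorem box_hom_ext {Y Y' : C} {V W : FGModuleCat.{w} k}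
    {f g : Y ⊗ (vecTensor k C).obj V ⟶ Y' ⊗ (vecTensor k C).obj W}
    (h : ∀ l m, boxι Y V l ≫ f ≫ boxπ Y' W m = boxι Y V l ≫ g ≫ boxπ Y' W m) : f = g := by
  have hV := isDirectSum_box Y V
  have hW := isDirectSum_box Y' W
  have key : ∀ t : Y ⊗ (vecTensor k C).obj V ⟶ Y' ⊗ (vecTensor k C).obj W,
      t = ∑ l, ∑ m, boxπ Y V l ≫ (boxι Y V l ≫ t ≫ boxπ Y' W m) ≫ boxι Y' W m := by
    intro t
    conv_lhs => rw [← Category.id_comp t, ← Category.comp_id (𝟙 _ ≫ t), ← hV.total, ← hW.total]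
    simp only [Preadditive.sum_comp, Preadditive.comp_sum, Category.assoc]
    rw [Finset.sum_comm]
  rw [key f, key g]
  simp only [h]

theorem vecTensor_map_injective {Y : C} [Simple Y] {V W : FGModuleCat.{w} k} {f g : V ⟶ W}
    (h : Y ◁ (vecTensor k C).map f = Y ◁ (vecTensor k C).map g) : f = g := by
  apply FGModuleCat.hom_ext
  apply (LinearMap.toMatrix (Module.finBasis k V) (Module.finBasis k W)).injective
  ext m l
  have h1 := boxι_map_boxπ Y f l m
  rw [h, boxι_map_boxπ] at h1
  exact (smul_left_injective k (id_nonzero Y) h1).symm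

variable [IsAlgClosed k] [IsFusion k C]

/-- Since `End Y = k`, a morphism between sums of copies of `Y` is a matrix of scalars. -/
theorem vecTensor_map_surjective {Y : C} [Simple Y] {V W : FGModuleCat.{w} k}
    (φ : Y ⊗ (vecTensor k C).obj V ⟶ Y ⊗ (vecTensor k C).obj W) :
    ∃ f : V ⟶ W, φ = Y ◁ (vecTensor k C).map f := by
  refine ⟨FGModuleCat.ofHom (Matrix.toLin (Module.finBasis k V) (Module.finBasis k W)
    (Matrix.of fun m l => scalar k (boxι Y V l ≫ φ ≫ boxπ Y W m))), box_hom_ext fun l m => ?_⟩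
  rw [boxι_map_boxπ]
  have : ∀ M : Matrix _ _ k, LinearMap.toMatrix (Module.finBasis k V) (Module.finBasis k W)
    (FGModuleCat.ofHom (Matrix.toLin (Module.finBasis k V) (Module.finBasis k W) M)).hom.hom
    = M := fun M => LinearMap.toMatrix_toLin _ _ M
  rw [this, Matrix.of_apply, scalar_smul_id]

variable [SymmetricCategory C] [RightRigidCategory C]

/-- By naturality `e` acts on every copy of `Y` in `Y ⊗ (V ⊗ 𝟙)` as `e.app Y`, so the trace factors.
-/
theorem tr_box_map (Y : C) {V : FGModuleCat.{w} k} (f : V ⟶ V) (e : 𝟭 C ⟶ 𝟭 C) :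
    tr k (e.app (Y ⊗ (vecTensor k C).obj V) ≫ Y ◁ (vecTensor k C).map f) =
      LinearMap.trace k V f.hom.hom * tr k (e.app Y) := by
  rw [(isDirectSum_box Y V).tr_eq, LinearMap.trace_eq_matrix_trace k (Module.finBasis k V),
    Matrix.trace, Finset.sum_mul]
  refine Finset.sum_congr rfl fun l _ => ?_
  have h := e.naturality (boxι Y V l)
  simp only [Functor.id_map, Functor.id_obj] at h ⊢
  rw [Matrix.diag_apply, ← tr_smul, Category.assoc, ← Category.assoc, h, Category.assoc,
    boxι_map_boxπ, Linear.comp_smul, Category.comp_id]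

end Box

/-! ### Endomorphisms of the indecomposable representations -/

section Jordan

variable (k : Type w) [Field k] (p : ℕ) [Fact p.Prime]

theorem cyc_eq_pow (g : Cyc p) :
    g = Multiplicative.ofAdd (1 : ZMod p) ^ (Multiplicative.toAdd g).val := by
  apply Multiplicative.toAdd.injective
  simp

theorem cyc_pow (g : Cyc p) : g ^ p = 1 := by
  apply Multiplicative.toAdd.injective
  simp

/-- The augmentation of the group algebra. -/
def augmentation : MonoidAlgebra k (Cyc p) →ₐ[k] k := MonoidAlgebra.lift k k (Cyc p) 1

theorem augmentation_of (g : Cyc p) : augmentation k p (MonoidAlgebra.of k (Cyc p) g) = 1 := by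
  simp [augmentation]

/-- Both sides are additive in `x`, and every group element has `p`-th power `1`. Consequently
elements of augmentation zero are nilpotent. -/
theorem pow_char_eq [CharP k p] (x : MonoidAlgebra k (Cyc p)) :
    x ^ p = algebraMap k _ (augmentation k p x ^ p) := by
  have : CharP (MonoidAlgebra k (Cyc p)) p :=
    charP_of_injective_algebraMap (algebraMap k (MonoidAlgebra k (Cyc p))).injective p
  induction x using MonoidAlgebra.induction_on with
  | of g => rw [← map_pow, cyc_pow, augmentation_of, one_pow, map_one, map_one]
  | add x y hx hy => rw [add_pow_char, hx, hy, map_add, add_pow_char, map_add]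
  | smul c x hx =>
    rw [smul_pow, hx, map_smul, smul_eq_mul, mul_pow, map_mul, Algebra.smul_def]

/-- The class of the generator. -/
def jordanGen (s : ℕ) : JordanRing k p s :=
  Ideal.Quotient.mk _ (MonoidAlgebra.of k (Cyc p) (Multiplicative.ofAdd 1))

theorem jordanGen_sub_one_pow (s : ℕ) : (jordanGen k p s - 1) ^ s = 0 := by
  rw [jordanGen, ← map_one (Ideal.Quotient.mk _), ← map_sub, ← map_pow,
    Ideal.Quotient.eq_zero_iff_mem]
  exact Ideal.subset_span rfl

open Polynomial in
-- The ring is `k[X]/(X - 1)^s`: for `s ≤ p` the polynomial `(X - 1)^s` divides `(X - 1)^p = X^p -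
-- 1`, so the relation `σ^p = 1` imposes nothing further.
theorem finrank_jordanRing [CharP k p] {s : ℕ} (hs : s ≤ p) :
    Module.finrank k (JordanRing k p s) = s := by
  have hmonic : ((X - 1 : k[X]) ^ s).Monic := by
    simpa using (monic_X_sub_C (1 : k)).pow s
  have hdeg : ((X - 1 : k[X]) ^ s).natDegree = s := by
    have := natDegree_X_sub_C (1 : k)
    rw [map_one] at this
    rw [natDegree_pow, this, mul_one]
  set B := AdjoinRoot ((X - 1 : k[X]) ^ s) with hB
  let r : B := AdjoinRoot.root _
  have hr : (r - 1) ^ s = 0 := by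
    have := AdjoinRoot.eval₂_root ((X - 1 : k[X]) ^ s)
    rwa [eval₂_pow, eval₂_sub, eval₂_X, eval₂_one] at this
  have hrp : r ^ p = 1 := by
    rcases subsingleton_or_nontrivial B with h | h
    · exact Subsingleton.elim _ _
    · have : CharP B p := charP_of_injective_algebraMap (algebraMap k B).injective p
      have h1 : (r - 1) ^ p = 0 := pow_eq_zero_of_le hs hr
      rwa [sub_pow_char, one_pow, sub_eq_zero] at h1
  let Φ : B →ₐ[k] JordanRing k p s := AdjoinRoot.liftAlgHom _ (Algebra.ofId _ _) (jordanGen k p s)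
    (by simpa using jordanGen_sub_one_pow k p s)
  let ρ : Cyc p →* B :=
    { toFun := fun g => r ^ (Multiplicative.toAdd g).val
      map_one' := by simp
      map_mul' := fun g h => by
        rw [toAdd_mul, ZMod.val_add, ← pow_add,
          pow_eq_pow_mod ((Multiplicative.toAdd g).val + (Multiplicative.toAdd h).val) hrp] }
  have hρ : ρ (Multiplicative.ofAdd 1) = r := by
    have : Fact (1 < p) := ⟨(Fact.out : p.Prime).one_lt⟩
    change r ^ (1 : ZMod p).val = r
    rw [ZMod.val_one, pow_one]
  let Ψ : JordanRing k p s →ₐ[k] B := Ideal.Quotient.liftₐ _ (MonoidAlgebra.lift k B (Cyc p) ρ) (by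
    intro a ha
    have : Ideal.span {((MonoidAlgebra.of k (Cyc p) (Multiplicative.ofAdd 1) - 1) ^ s :
      MonoidAlgebra k (Cyc p))} ≤ RingHom.ker (MonoidAlgebra.lift k B (Cyc p) ρ) := by
      rw [Ideal.span_singleton_le_iff_mem, RingHom.mem_ker, map_pow, map_sub,
        map_one (MonoidAlgebra.lift k B (Cyc p) ρ), MonoidAlgebra.lift_of, hρ, hr]
    exact this ha)
  have hΦ : Φ r = jordanGen k p s := AdjoinRoot.liftAlgHom_root _ _ _ _
  have hΨ : Ψ (jordanGen k p s) = r := by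
    change MonoidAlgebra.lift k B (Cyc p) ρ
      (MonoidAlgebra.of k (Cyc p) (Multiplicative.ofAdd 1)) = r
    rw [MonoidAlgebra.lift_of, hρ]
  have h1 : Ψ.comp Φ = AlgHom.id k B := by
    apply AdjoinRoot.algHom_ext
    change Ψ (Φ r) = r
    rw [hΦ, hΨ]
  have h2 : Φ.comp Ψ = AlgHom.id k _ := by
    apply Ideal.Quotient.algHom_ext
    refine MonoidAlgebra.algHom_ext (fun g => ?_) (Subsingleton.elim _ _)
    change Φ (MonoidAlgebra.lift k B (Cyc p) ρ (MonoidAlgebra.of k (Cyc p) g)) =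
      Ideal.Quotient.mk _ (MonoidAlgebra.of k (Cyc p) g)
    rw [MonoidAlgebra.lift_of, cyc_eq_pow p g, map_pow, map_pow, map_pow, hρ, map_pow, hΦ]
    rfl
  rw [← (AlgEquiv.ofAlgHom Φ Ψ h2 h1).toLinearEquiv.finrank_eq,
    (AdjoinRoot.powerBasis' hmonic).finrank, AdjoinRoot.powerBasis'_dim, hdeg]

/-- The augmentation of `k[σ]/(σ - 1)^s`. -/
def jordanAugmentation {s : ℕ} (hs : s ≠ 0) : JordanRing k p s →ₐ[k] k :=
  Ideal.Quotient.liftₐ _ (augmentation k p) (by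
    intro a ha
    have : Ideal.span {((MonoidAlgebra.of k (Cyc p) (Multiplicative.ofAdd 1) - 1) ^ s :
      MonoidAlgebra k (Cyc p))} ≤ RingHom.ker (augmentation k p) := by
      rw [Ideal.span_singleton_le_iff_mem, RingHom.mem_ker, map_pow, map_sub,
        map_one (augmentation k p), augmentation_of, sub_self, zero_pow hs]
    exact this ha)

/-- Every element is its augmentation plus a nilpotent element; multiplication by the nilpotent part
has trace zero and the scalar part is counted `s` times. -/
theorem jordanRing_trace_lmul [CharP k p] {s : ℕ} (hs : s ≠ 0) (hsp : s ≤ p)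
    (a : JordanRing k p s) : LinearMap.trace k _ (Algebra.lmul k (JordanRing k p s) a) =
      s * jordanAugmentation k p hs a := by
  obtain ⟨x, rfl⟩ := Ideal.Quotient.mk_surjective a
  set c := augmentation k p x
  have hc : jordanAugmentation k p hs (Ideal.Quotient.mk _ x) = c := rfl
  have : CharP (MonoidAlgebra k (Cyc p)) p :=
    charP_of_injective_algebraMap (algebraMap k (MonoidAlgebra k (Cyc p))).injective p
  have hnil : (x - algebraMap k _ c) ^ p = 0 := by
    rw [sub_pow_char, pow_char_eq, ← map_pow (algebraMap k _), sub_self]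
  set n : JordanRing k p s := Ideal.Quotient.mk _ (x - algebraMap k _ c) with hn
  have hx : (Ideal.Quotient.mk _ x : JordanRing k p s) = n + algebraMap k _ c := by
    rw [hn, map_sub]
    exact (sub_add_cancel _ _).symm
  have hn0 : IsNilpotent n := ⟨p, by rw [hn, ← map_pow, hnil, map_zero]⟩
  have ht : LinearMap.trace k _ (Algebra.lmul k (JordanRing k p s) n) = 0 :=
    (LinearMap.isNilpotent_trace_of_isNilpotent (hn0.map (Algebra.lmul k _))).eq_zero
  rw [hc, hx, map_add, map_add, ht, zero_add, AlgHom.commutes, Algebra.algebraMap_eq_smul_one,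
    map_smul, LinearMap.trace_one, finrank_jordanRing k p hsp, smul_eq_mul, mul_comm]

variable {k p} in
/-- The linear endomorphism underlying an endomorphism of `L_s`. -/
def jordanLin {s : ℕ} (f : jordanRep k p s ⟶ jordanRep k p s) :
    JordanRing k p s →ₗ[k] JordanRing k p s := f.hom.hom.hom

theorem jordanLin_mk_of_mul {s : ℕ} (f : jordanRep k p s ⟶ jordanRep k p s) (g : Cyc p)
    (b : JordanRing k p s) :
    jordanLin f (Ideal.Quotient.mk _ (MonoidAlgebra.of k (Cyc p) g) * b) =
      Ideal.Quotient.mk _ (MonoidAlgebra.of k (Cyc p) g) * jordanLin f b :=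
  LinearMap.congr_fun (congrArg (fun t => t.hom.hom) (f.comm g)) b

theorem jordanLin_mul {s : ℕ} (f : jordanRep k p s ⟶ jordanRep k p s) (a b : JordanRing k p s) :
    jordanLin f (a * b) = a * jordanLin f b := by
  obtain ⟨x, rfl⟩ := Ideal.Quotient.mk_surjective a
  generalize hL : jordanLin f = L
  induction x using MonoidAlgebra.induction_on with
  | of g => rw [← hL]; exact jordanLin_mk_of_mul k p f g b
  | add x y hx hy => rw [map_add, add_mul, add_mul, map_add, hx, hy]
  | smul c x hx =>
    have hc : (Ideal.Quotient.mk _ (c • x) : JordanRing k p s) = c • Ideal.Quotient.mk _ x := rfl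
    rw [hc, smul_mul_assoc, map_smul, hx, smul_mul_assoc]

/-- An endomorphism of a cyclic module over a commutative ring is multiplication by the image of
`1`. -/
theorem jordanLin_eq {s : ℕ} (f : jordanRep k p s ⟶ jordanRep k p s) :
    jordanLin f = Algebra.lmul k (JordanRing k p s) (jordanLin f 1) := by
  refine LinearMap.ext fun a => ?_
  have h := jordanLin_mul k p f a 1
  rw [mul_one] at h
  rw [h]
  exact mul_comm _ _

/-- The eigenvalue of an endomorphism of `L_s`. -/
def jordanEigenvalue {s : ℕ} (hs : s ≠ 0) (f : jordanRep k p s ⟶ jordanRep k p s) : k :=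
  jordanAugmentation k p hs (jordanLin f 1)

theorem jordanEigenvalue_comp {s : ℕ} (hs : s ≠ 0) (f g : jordanRep k p s ⟶ jordanRep k p s) :
    jordanEigenvalue k p hs (f ≫ g) = jordanEigenvalue k p hs f * jordanEigenvalue k p hs g := by
  have h : jordanLin (f ≫ g) 1 = jordanLin g (jordanLin f 1) := rfl
  rw [jordanEigenvalue, h, jordanLin_eq k p g, mul_comm, jordanEigenvalue, jordanEigenvalue,
    ← map_mul]
  rfl

theorem trace_jordanRep [CharP k p] {s : ℕ} (hs : s ≠ 0) (hsp : s ≤ p)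
    (f : jordanRep k p s ⟶ jordanRep k p s) :
    LinearMap.trace k (jordanRep k p s).V f.hom.hom.hom = s * jordanEigenvalue k p hs f := by
  rw [jordanEigenvalue, ← jordanRing_trace_lmul k p hs hsp, ← jordanLin_eq]
  rfl

end Jordan

/-! ### Retracts modulo negligible morphisms -/

section Retracts

variable {C : Type u} [Category.{v} C] [MonoidalCategory C] [SymmetricCategory C]
  [RightRigidCategory C] [Preadditive C] [MonoidalPreadditive C]

theorem negligible_zero {X Y : C} : Negligible (0 : X ⟶ Y) := fun u => by
  rw [comp_zero, trace_zero]

theorem Negligible.sum {ι : Type*} (s : Finset ι) {X Y : C} {f : ι → (X ⟶ Y)}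
    (hf : ∀ i ∈ s, Negligible (f i)) : Negligible (∑ i ∈ s, f i) := by
  induction s using Finset.cons_induction with
  | empty => exact negligible_zero
  | cons a s ha ih =>
    rw [Finset.sum_cons]
    exact (hf a (by simp)).add (ih fun i hi => hf i (by simp [hi]))

theorem Negligible.smul {k : Type w} [Field k] [Linear k C] {X Y : C} {f : X ⟶ Y}
    (hf : Negligible f) (c : k) : Negligible (c • f) := by
  have := hf.precomp (c • 𝟙 X)
  rwa [Linear.smul_comp, Category.id_comp] at this

theorem toQuotient_map_eq_iff {X Y : C} (f g : X ⟶ Y) :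
    (toQuotient C).map f = (toQuotient C).map g ↔ Negligible (f - g) :=
  Quotient.functor_map_eq_iff (negligibleRel C) f g

/-- `A` becomes a retract of `B` in the quotient by negligible morphisms. -/
def QuotientRetract (A B : C) : Prop := ∃ (a : A ⟶ B) (b : B ⟶ A), Negligible (𝟙 A - a ≫ b)

theorem quotientRetract_of_retract {A B : C}
    (h : Retract ((toQuotient C).obj A) ((toQuotient C).obj B)) : QuotientRetract A B := by
  obtain ⟨a, ha⟩ := (toQuotient C).map_surjective h.i
  obtain ⟨b, hb⟩ := (toQuotient C).map_surjective h.r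
  refine ⟨a, b, (toQuotient_map_eq_iff _ _).1 ?_⟩
  rw [Functor.map_comp, ha, hb, h.retract]
  exact ((toQuotient C).map_id A).symm

/-- If all endomorphisms of `A` are scalar in the quotient, then a retract of a direct sum is a
retract of one of the summands. -/
theorem QuotientRetract.exists_summand (k : Type w) [Field k] [Linear k C] {A B : C}
    (hA : ∀ f : A ⟶ A, ∃ c : k, Negligible (f - c • 𝟙 A)) (hA' : ¬ Negligible (𝟙 A))
    (h : QuotientRetract A B) {ι : Type*} [Fintype ι] (S : ι → C) (i : ∀ l, S l ⟶ B)
    (q : ∀ l, B ⟶ S l) (total : Negligible (𝟙 B - ∑ l, q l ≫ i l)) :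
    ∃ l, QuotientRetract A (S l) := by
  obtain ⟨a, b, hab⟩ := h
  choose c hc using fun l => hA ((a ≫ q l) ≫ i l ≫ b)
  -- The identity of `A` is, modulo negligibles, the sum of the composites through the summands, so
  -- these scalars cannot all vanish. A nonzero one is inverted to give the retraction.
  obtain ⟨l, hl⟩ : ∃ l, c l ≠ 0 := by
    by_contra! hcon
    apply hA'
    have h1 : Negligible (∑ l, (a ≫ q l) ≫ i l ≫ b) := Negligible.sum _ fun l _ => by
      simpa [hcon l] using hc l
    have h2 : 𝟙 A = (𝟙 A - a ≫ b) + a ≫ (𝟙 B - ∑ l, q l ≫ i l) ≫ b +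
        ∑ l, (a ≫ q l) ≫ i l ≫ b := by
      simp [Preadditive.sub_comp, Preadditive.comp_sub, Preadditive.sum_comp, Preadditive.comp_sum]
    rw [h2]
    exact (hab.add ((total.postcomp b).precomp a)).add h1
  refine ⟨l, a ≫ q l, (c l)⁻¹ • i l ≫ b, ?_⟩
  have := ((hc l).smul (c l)⁻¹).neg
  rw [smul_sub, smul_smul, inv_mul_cancel₀ hl, one_smul, neg_sub] at this
  simpa using this

end Retracts

/-! ### Objects of the form `Y ⊠ V` -/

section Box

variable {k : Type w} [Field k] {C : Type u} [Category.{v} C] [Abelian C]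
  [Linear k C] [MonoidalCategory C] [SymmetricCategory C] [RightRigidCategory C]
  [MonoidalPreadditive C] {p : ℕ} [NeZero p]

/-- The functoriality of `Y ⊠ V` in `V`. -/
def boxMap (Y : C) {V W : FDRep k (Cyc p)} (f : V ⟶ W) : box k C p Y V ⟶ box k C p Y W :=
  Action.trivial (Cyc p) Y ◁ ((vecTensor k C).mapAction (Cyc p)).map f

theorem boxMap_hom (Y : C) {V W : FDRep k (Cyc p)} (f : V ⟶ W) :
    (boxMap Y f).hom = Y ◁ (vecTensor k C).map f.hom := rfl

theorem boxMap_comp (Y : C) {U V W : FDRep k (Cyc p)} (f : U ⟶ V) (g : V ⟶ W) :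
    boxMap (C := C) Y (f ≫ g) = boxMap Y f ≫ boxMap Y g := by
  rw [boxMap, Functor.map_comp]
  exact MonoidalCategory.whiskerLeft_comp _ _ _

theorem boxMap_id (Y : C) (V : FDRep k (Cyc p)) :
    boxMap (C := C) Y (𝟙 V) = 𝟙 _ := by
  simp [boxMap, box]

instance : (vecTensor k C).Additive where
  map_add {V W f g} := by
    have key : ∀ {m n : ℕ} (A B D : Fin m → Fin n → (𝟙_ C ⟶ 𝟙_ C)),
        (∀ i j, A i j = B i j + D i j) →
        biproduct.matrix A = biproduct.matrix B + biproduct.matrix D := by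
      intro m n A B D h
      ext i j
      simp [h]
    refine key _ _ _ fun i j => ?_
    rw [← add_smul]
    congr 1
    exact congrFun (congrFun (map_add (LinearMap.toMatrix (Module.finBasis k V)
      (Module.finBasis k W)) f.hom.hom g.hom.hom) j) i

theorem boxMap_sub (Y : C) {V W : FDRep k (Cyc p)} (f g : V ⟶ W) :
    boxMap (C := C) Y (f - g) = boxMap Y f - boxMap Y g := by
  apply Action.Hom.ext
  rw [Action.sub_hom, boxMap_hom, boxMap_hom, boxMap_hom, Action.sub_hom, Functor.map_sub]
  exact (tensorLeft Y).map_sub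

theorem boxMap_sum (Y : C) {V W : FDRep k (Cyc p)} {ι : Type*} (s : Finset ι) (f : ι → (V ⟶ W)) :
    boxMap (C := C) Y (∑ i ∈ s, f i) = ∑ i ∈ s, boxMap Y (f i) := by
  apply Action.Hom.ext
  rw [Action.sum_hom, boxMap_hom, Action.sum_hom, Functor.map_sum]
  exact (tensorLeft Y).map_sum _ _

/-- The functoriality of `Y ⊠ V` in `Y`. -/
def boxMapLeft {Y Z : C} (f : Y ⟶ Z) (V : FDRep k (Cyc p)) : box k C p Y V ⟶ box k C p Z V :=
  (⟨f, fun _ => (Category.id_comp f).trans (Category.comp_id f).symm⟩ :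
    Action.trivial (Cyc p) Y ⟶ Action.trivial (Cyc p) Z) ▷
    ((vecTensor k C).mapAction (Cyc p)).obj V

theorem boxMapLeft_total {Z : C} {ι : Type*} [Fintype ι] {S : ι → C} {i : ∀ l, S l ⟶ Z}
    {q : ∀ l, Z ⟶ S l} (h : IsDirectSum Z S i q) (V : FDRep k (Cyc p)) :
    ∑ l, boxMapLeft (q l) V ≫ boxMapLeft (i l) V = 𝟙 (box k C p Z V) := by
  apply Action.Hom.ext
  rw [Action.sum_hom]
  exact (h.map (tensorRight ((vecTensor k C).obj V.V))).total

variable [MonoidalLinear k C] [IsAlgClosed k] [IsFusion k C]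

theorem box_ρ (Y : C) (V : FDRep k (Cyc p)) (g : Cyc p) :
    (box k C p Y V).ρ g = Y ◁ (vecTensor k C).map (Action.ρ V g) :=
  id_tensorHom _ _

theorem equivariant_of_whiskerLeft {Y : C} [Simple Y] {V W : FDRep k (Cyc p)} (f : V.V ⟶ W.V)
    (g : Cyc p)
    (h : Y ◁ (vecTensor k C).map (Action.ρ V g) ≫ Y ◁ (vecTensor k C).map f =
      Y ◁ (vecTensor k C).map f ≫ Y ◁ (vecTensor k C).map (Action.ρ W g)) :
    Action.ρ V g ≫ f = f ≫ Action.ρ W g := by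
  apply vecTensor_map_injective (C := C) (Y := Y)
  rw [Functor.map_comp, Functor.map_comp, MonoidalCategory.whiskerLeft_comp,
    MonoidalCategory.whiskerLeft_comp]
  exact h

/-- Fullness of `V ↦ Y ⊗ (V ⊗ 𝟙)` gives a linear map, and faithfulness lets equivariance descend to
it. -/
theorem boxMap_surjective {Y : C} [Simple Y] {V W : FDRep k (Cyc p)}
    (φ : box k C p Y V ⟶ box k C p Y W) : ∃ f : V ⟶ W, φ = boxMap Y f := by
  obtain ⟨f, hf⟩ := vecTensor_map_surjective (k := k) (Y := Y) (V := V.V) (W := W.V) φ.hom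
  have hcomm : ∀ g, Action.ρ V g ≫ f = f ≫ Action.ρ W g := by
    intro g
    apply equivariant_of_whiskerLeft (C := C) (Y := Y)
    rw [← hf, ← box_ρ, ← box_ρ]
    exact φ.comm g
  exact ⟨⟨f, hcomm⟩, Action.Hom.ext hf⟩

/-- Every test morphism comes from representations, and the resulting trace is a multiple of a trace
in `FDRep`. Hence decompositions in `Ver_p` carry over to `Y ⊠ V`. -/
theorem Negligible.boxMap {Y : C} [Simple Y] {V W : FDRep k (Cyc p)} {f : V ⟶ W}
    (hf : Negligible f) : Negligible (boxMap (C := C) Y f) := by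
  intro u
  obtain ⟨g, rfl⟩ := boxMap_surjective u
  have h := tr_box_map (k := k) Y (g ≫ f).hom (𝟙 (𝟭 C))
  rw [hf.linearMap_trace_eq_zero g, zero_mul, tr_eq_iff, zero_smul] at h
  have h2 : trace (SymFus.boxMap Y (g ≫ f) : box k C p Y W ⟶ box k C p Y W).hom = 0 := by
    rw [boxMap_hom]
    exact (congrArg trace (Category.id_comp _).symm).trans h
  rw [← boxMap_comp]
  exact Action.Hom.ext ((trace_hom _).trans h2)

/-- A retract of `Y ⊠ V` is a retract of `Y ⊠ J t` for some `t` if `V` is a retract of the direct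
sum of the representations `J t`. -/
theorem QuotientRetract.exists_box_summand {A : Action C (Cyc p)}
    (hA : ∀ f : A ⟶ A, ∃ c : k, Negligible (f - c • 𝟙 A)) (hA' : ¬ Negligible (𝟙 A)) {Y : C}
    [Simple Y] {V : FDRep k (Cyc p)} (h : QuotientRetract A (box k C p Y V)) {n : ℕ}
    {J : Fin n → FDRep k (Cyc p)} (hV : QuotientRetract V (⨁ J)) :
    ∃ t, QuotientRetract A (box k C p Y (J t)) := by
  obtain ⟨a, b, hab⟩ := hV
  refine h.exists_summand k hA hA' (fun t => box k C p Y (J t))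
    (fun t => boxMap Y (biproduct.ι J t ≫ b)) (fun t => boxMap Y (a ≫ biproduct.π J t)) ?_
  have h1 : ∀ t, (a ≫ biproduct.π J t) ≫ biproduct.ι J t ≫ b =
      a ≫ (biproduct.π J t ≫ biproduct.ι J t) ≫ b := by simp
  have h2 : ∑ t, (a ≫ biproduct.π J t) ≫ biproduct.ι J t ≫ b = a ≫ b := by
    simp only [h1]
    rw [← Preadditive.comp_sum, ← Preadditive.sum_comp, biproduct.total, Category.id_comp]
  simp only [← boxMap_comp]
  rw [← boxMap_sum, h2, ← boxMap_id, ← boxMap_sub]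
  exact hab.boxMap

end Box

/-! ### The Frobenius functor on simple objects -/

section Frobenius

variable {k : Type w} [Field k] {C : Type u} [Category.{v} C] [Abelian C]
  [Linear k C] [MonoidalCategory C] [SymmetricCategory C] [RightRigidCategory C]
  [MonoidalPreadditive C] [MonoidalLinear k C] {p : ℕ} [Fact p.Prime]

theorem tensorPowMap_smul {X Y : C} (c : k) (f : X ⟶ Y) (n : ℕ) :
    tensorPowMap (c • f) n = c ^ n • tensorPowMap f n := by
  induction n with
  | zero => simp [tensorPowMap]
  | succ n ih =>
    rw [tensorPowMap, ih, tensorPowMap, MonoidalCategory.tensorHom_def,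
      MonoidalCategory.tensorHom_def, pow_succ']
    simp [smul_smul, mul_comm]

theorem tensorPowMap_zero {X Y : C} {n : ℕ} (hn : n ≠ 0) : tensorPowMap (0 : X ⟶ Y) n = 0 := by
  obtain ⟨n, rfl⟩ := Nat.exists_eq_succ_of_ne_zero hn
  rw [tensorPowMap, MonoidalCategory.tensorHom_def]
  simp

variable (hinj : IsFrobeniusInjective C p)

include hinj

theorem exists_map_of_hom {X Y : C} (φ : (cyclicPower C p).obj X ⟶ (cyclicPower C p).obj Y) :
    ∃ f : X ⟶ Y, Negligible (φ - (cyclicPower C p).map f) := by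
  have := hinj.1
  obtain ⟨f, hf⟩ := (frobenius C p).map_surjective ((toQuotient _).map φ)
  exact ⟨f, (toQuotient_map_eq_iff _ _).1 hf.symm⟩

/-- Faithfulness separates `𝟙 X` from `0`, and `Fr 0 = 0`. -/
theorem not_negligible_id (X : C) [Simple X] :
    ¬ Negligible (𝟙 ((cyclicPower C p).obj X)) := by
  intro h
  have := hinj.2
  apply id_nonzero X
  apply (frobenius C p).map_injective
  refine (toQuotient_map_eq_iff ((cyclicPower C p).map (𝟙 X)) ((cyclicPower C p).map 0)).2 ?_
  have h0 : (cyclicPower C p).map (0 : X ⟶ X) = 0 :=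
    Action.Hom.ext (tensorPowMap_zero (Fact.out : p.Prime).ne_zero)
  rw [h0, sub_zero, CategoryTheory.Functor.map_id]
  exact h

/-- By fullness `φ` agrees with some `f^{⊗p}` modulo negligibles; then `f ≠ 0`, and Schur's lemma
applies. -/
theorem nonempty_iso_of_not_negligible {X Y : C} [Simple X] [Simple Y]
    {φ : (cyclicPower C p).obj X ⟶ (cyclicPower C p).obj Y} (hφ : ¬ Negligible φ) :
    Nonempty (X ≅ Y) := by
  obtain ⟨f, hf⟩ := exists_map_of_hom hinj φ
  have hf0 : f ≠ 0 := by
    rintro rfl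
    have h0 : (cyclicPower C p).map (0 : X ⟶ Y) = 0 :=
      Action.Hom.ext (tensorPowMap_zero (Fact.out : p.Prime).ne_zero)
    rw [h0, sub_zero] at hf
    exact hφ hf
  have := isIso_of_hom_simple hf0
  exact ⟨asIso f⟩

variable [IsAlgClosed k] [IsFusion k C]

theorem exists_scalar (X : C) [Simple X]
    (φ : (cyclicPower C p).obj X ⟶ (cyclicPower C p).obj X) :
    ∃ c : k, Negligible (φ - c • 𝟙 ((cyclicPower C p).obj X)) := by
  obtain ⟨f, hf⟩ := exists_map_of_hom hinj φ
  obtain ⟨c, rfl⟩ := exists_smul_id k f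
  -- The `p`-th tensor power of `c • 𝟙 X` is multiplied by `c ^ p`.
  refine ⟨c ^ p, ?_⟩
  have h : (cyclicPower C p).map (c • 𝟙 X) = c ^ p • 𝟙 ((cyclicPower C p).obj X) := by
    apply Action.Hom.ext
    change tensorPowMap (c • 𝟙 X) p = c ^ p • 𝟙 (tensorPow X p)
    rw [tensorPowMap_smul, tensorPowMap_id]
  rwa [h] at hf

/-- If the image of the Frobenius functor is contained in `C ⊠ sVec`, then simple objects are sent
to retracts of objects `Y ⊠ L_1` and `Y ⊠ L_{p-1}` with `Y` simple. -/
theorem exists_quotientRetract_box (X : C) [Simple X]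
    (hX : boxSubcategory k C p (sVec k p) ((frobenius C p).obj X)) :
    ∃ (Y : C) (_ : Simple Y) (s : ℕ), (s = 1 ∨ s = p - 1) ∧
      QuotientRetract ((cyclicPower C p).obj X) (box k C p Y (jordanRep k p s)) := by
  have hA := exists_scalar (k := k) hinj X
  have hA' := not_negligible_id hinj X
  obtain ⟨n, Y, V, hV, ⟨ret⟩⟩ := hX
  have h1 : QuotientRetract ((cyclicPower C p).obj X) (⨁ fun i => box k C p (Y i) (V i)) :=
    quotientRetract_of_retract ret
  -- As `End(Fr X)` is scalar, the same selection of a summand applies three times: to the sum of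
  -- boxes, to the simple constituents of `Y l`, and to the Jordan blocks of `V l`.
  obtain ⟨l, hl⟩ := h1.exists_summand k hA hA' (fun i => box k C p (Y i) (V i))
    (biproduct.ι _) (biproduct.π _) (by
      rw [biproduct.total, sub_self]
      exact negligible_zero)
  obtain ⟨m, S, i, q, hS, hY⟩ := exists_isDirectSum k (Y l)
  obtain ⟨j, hj⟩ := hl.exists_summand k hA hA' (fun j => box k C p (S j) (V l))
    (fun j => boxMapLeft (i j) _) (fun j => boxMapLeft (q j) _) (by
      rw [boxMapLeft_total hY, sub_self]
      exact negligible_zero)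
  have := hS j
  obtain ⟨N, s, hs, ⟨e⟩⟩ := hV l
  have hV' : QuotientRetract (V l) (⨁ fun i => jordanRep k p (s i)) :=
    quotientRetract_of_retract ⟨e.hom, e.inv, e.hom_inv_id⟩
  obtain ⟨t, ht⟩ := hj.exists_box_summand hA hA' hV'
  exact ⟨S j, inferInstance, s t, hs t, ht⟩

omit hinj

/-- Cyclicity of the trace persists in the presence of `e`, which slides past `b` by naturality. -/
theorem tr_comp_of_natural (e : 𝟭 C ⟶ 𝟭 C) {A B : C} (a : A ⟶ B) (b : B ⟶ A) :
    tr k (e.app A ≫ a ≫ b) = tr k (e.app B ≫ b ≫ a) := by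
  have h := e.naturality b
  simp only [Functor.id_map, Functor.id_obj] at h ⊢
  rw [← Category.assoc, tr_comp_comm, ← Category.assoc, h, Category.assoc]

variable [CharP k p]

/-- The trace of an endomorphism of `Y ⊠ L_s`. -/
theorem tr_box_jordan {Y : C} [Simple Y] {s : ℕ} (hs : s ≠ 0) (hsp : s ≤ p) (e : 𝟭 C ⟶ 𝟭 C)
    (f : jordanRep k p s ⟶ jordanRep k p s) :
    tr k (e.app (box k C p Y (jordanRep k p s)).V ≫ (boxMap Y f).hom) =
      s * jordanEigenvalue k p hs f * tr k (e.app Y) := by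
  rw [← trace_jordanRep k p hs hsp]
  exact tr_box_map Y f.hom e

/-- The traces attached to an object that is a retract of `Y ⊠ L_s` in the quotient. -/
theorem exists_eigenvalue {A : Action C (Cyc p)} {Y : C} [Simple Y] {s : ℕ} (hs : s ≠ 0)
    (hsp : s ≤ p) (a : A ⟶ box k C p Y (jordanRep k p s)) (b : box k C p Y (jordanRep k p s) ⟶ A)
    (hab : Negligible (𝟙 A - a ≫ b)) :
    ∃ f : jordanRep k p s ⟶ jordanRep k p s, b ≫ a = boxMap Y f ∧
      ∀ e : 𝟭 C ⟶ 𝟭 C, tr k (e.app A.V) = s * jordanEigenvalue k p hs f * tr k (e.app Y) ∧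
        tr k (e.app A.V) = s * jordanEigenvalue k p hs f ^ 2 * tr k (e.app Y) := by
  obtain ⟨f, hf⟩ := boxMap_surjective (b ≫ a)
  refine ⟨f, hf, fun e => ⟨?_, ?_⟩⟩
  · have h := hab.tr_eq_zero k e
    rw [Action.sub_hom, Preadditive.comp_sub, tr_sub, sub_eq_zero] at h
    have h1 : tr k (e.app A.V) = tr k (e.app A.V ≫ (𝟙 A : A ⟶ A).hom) := by
      rw [Action.id_hom]
      exact congrArg (tr k) (Category.comp_id _).symm
    rw [h1, h, ← tr_box_jordan hs hsp, ← hf]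
    exact tr_comp_of_natural e a.hom b.hom
  -- The square of `a ≫ b` is also the identity modulo negligibles. Comparing with the first formula
  -- forces the eigenvalue to be `1` as soon as the trace is nonzero.
  · have h := (hab.add (hab.postcomp (a ≫ b))).tr_eq_zero k e
    have h0 : 𝟙 A - a ≫ b + (𝟙 A - a ≫ b) ≫ a ≫ b = 𝟙 A - (a ≫ b ≫ a) ≫ b := by
      simp [Preadditive.sub_comp]
    rw [h0, Action.sub_hom, Preadditive.comp_sub, tr_sub, sub_eq_zero] at h
    have h1 : tr k (e.app A.V) = tr k (e.app A.V ≫ (𝟙 A : A ⟶ A).hom) := by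
      rw [Action.id_hom]
      exact congrArg (tr k) (Category.comp_id _).symm
    rw [h1, h, pow_two, ← jordanEigenvalue_comp, ← tr_box_jordan hs hsp, boxMap_comp, ← hf]
    have h2 := tr_comp_of_natural (k := k) e (a ≫ b ≫ a).hom b.hom
    refine h2.trans ?_
    congr 2
    exact (congrArg Action.Hom.hom (Category.assoc b a (b ≫ a))).symm

end Frobenius

/-! ### Non-degeneracy -/

section Main

variable {k : Type w} [Field k] [IsAlgClosed k] {p : ℕ} [Fact p.Prime] [CharP k p]
  {C : Type u} [Category.{v} C] [Abelian C] [Linear k C]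
  [MonoidalCategory C] [SymmetricCategory C] [RightRigidCategory C] [MonoidalPreadditive C]
  [MonoidalLinear k C] [IsFusion k C]

/-- This is where `sVec` enters: its simple objects have dimension `±1`, as `p - 1 = -1` in `k`. -/
theorem cast_sq_eq_one {s : ℕ} (hs : s = 1 ∨ s = p - 1) : (s : k) ^ 2 = 1 := by
  rcases hs with rfl | rfl
  · simp
  · rw [Nat.cast_sub (Fact.out : p.Prime).one_le, CharP.cast_eq_zero]
    simp

/-- If the unit object occurs in a retract of `Y ⊠ L_s`, then `Y` is the unit object. -/
theorem quotientRetract_box_unit {A : Action C (Cyc p)} {Y : C} [Simple Y] {s : ℕ}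
    (hs : s = 1 ∨ s = p - 1) (h : QuotientRetract A (box k C p Y (jordanRep k p s)))
    (hA : (homDim k (𝟙_ C) A.V : k) ≠ 0) :
    QuotientRetract A (box k C p (𝟙_ C) (jordanRep k p s)) := by
  have hp := (Fact.out : p.Prime).two_le
  have hs0 : s ≠ 0 := by omega
  have hsp : s ≤ p := by omega
  have hunit : Simple (𝟙_ C) := IsFusion.simple_unit k
  obtain ⟨a, b, hab⟩ := h
  obtain ⟨f, -, hf⟩ := exists_eigenvalue hs0 hsp a b hab
  have h1 := (hf (unitProj k C)).1
  rw [tr_unitProj, tr_unitProj] at h1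
  -- The multiplicity of the unit in `A` is a multiple of that in `Y`, which is zero unless the
  -- simple object `Y` is the unit.
  have hY : (homDim k (𝟙_ C) Y : k) ≠ 0 := by
    intro h0
    rw [h0, mul_zero] at h1
    exact hA h1
  obtain ⟨e⟩ : Nonempty (𝟙_ C ≅ Y) := by
    by_contra hcon
    rw [homDim_simple, if_neg hcon] at hY
    exact hY Nat.cast_zero
  have htot := boxMapLeft_total (k := k) (p := p) (isDirectSum_of_iso e) (jordanRep k p s)
  rw [Finset.univ_unique, Finset.sum_singleton] at htot
  refine ⟨a ≫ boxMapLeft e.inv _, boxMapLeft e.hom _ ≫ b, ?_⟩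
  have : (a ≫ boxMapLeft e.inv (jordanRep k p s)) ≫ boxMapLeft e.hom (jordanRep k p s) ≫ b =
      a ≫ b := by
    rw [Category.assoc, ← Category.assoc (boxMapLeft e.inv _), htot, Category.id_comp]
  rwa [this]

/-- With `m` the multiplicity of the unit and `λ` the eigenvalue, `unitProj` gives `m = sλ = sλ²`;
as `m ≠ 0`, `λ = 1`. The identity transformation then gives the dimension. -/
theorem eigenvalue_of_quotientRetract {A : Action C (Cyc p)} {s : ℕ} (hs : s ≠ 0) (hsp : s ≤ p)
    (hA : (homDim k (𝟙_ C) A.V : k) ≠ 0) (a : A ⟶ box k C p (𝟙_ C) (jordanRep k p s))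
    (b : box k C p (𝟙_ C) (jordanRep k p s) ⟶ A) (hab : Negligible (𝟙 A - a ≫ b)) :
    ∃ f : jordanRep k p s ⟶ jordanRep k p s, b ≫ a = boxMap (𝟙_ C) f ∧
      jordanEigenvalue k p hs f = 1 ∧ (homDim k (𝟙_ C) A.V : k) = s ∧ sdim k A.V = s := by
  have hunit : Simple (𝟙_ C) := IsFusion.simple_unit k
  obtain ⟨f, hf, he⟩ := exists_eigenvalue hs hsp a b hab
  have hu : (homDim k (𝟙_ C) (𝟙_ C) : k) = 1 := by
    rw [homDim_simple, if_pos ⟨Iso.refl _⟩, Nat.cast_one]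
  obtain ⟨h1, h2⟩ := he (unitProj k C)
  rw [tr_unitProj, tr_unitProj, hu, mul_one] at h1 h2
  have hne : (s : k) * jordanEigenvalue k p hs f ≠ 0 := h1 ▸ hA
  have hone : jordanEigenvalue k p hs f = 1 := by
    apply mul_left_cancel₀ hne
    rw [mul_one, mul_assoc, ← pow_two, ← h1, ← h2]
  refine ⟨f, hf, hone, by rw [h1, hone, mul_one], ?_⟩
  have h3 := (he (𝟙 (𝟭 C))).1
  rw [hone, mul_one] at h3
  rw [show tr k ((𝟙 (𝟭 C) : 𝟭 C ⟶ 𝟭 C).app (𝟙_ C)) = 1 from sdim_unit k, mul_one] at h3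
  exact h3

theorem sdim_mul_homDim_of_quotientRetract {A : Action C (Cyc p)} {s : ℕ} (hs : s = 1 ∨ s = p - 1)
    (hA : (homDim k (𝟙_ C) A.V : k) ≠ 0)
    (h : QuotientRetract A (box k C p (𝟙_ C) (jordanRep k p s))) :
    sdim k A.V * (homDim k (𝟙_ C) A.V : k) = 1 := by
  have hp := (Fact.out : p.Prime).two_le
  obtain ⟨a, b, hab⟩ := h
  obtain ⟨f, -, -, h1, h2⟩ := eigenvalue_of_quotientRetract (by omega) (by omega) hA a b hab
  rw [h1, h2, ← pow_two, cast_sq_eq_one hs]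

/-- The composite through the common object `𝟙 ⊠ L_s` is not negligible: brought back to `𝟙 ⊠ L_s`
it has eigenvalue `1 · 1`, hence trace `s ≠ 0`. Frobenius injectivity then identifies `X` and `X'`.
-/
theorem nonempty_iso_of_quotientRetract (hinj : IsFrobeniusInjective C p) {X X' : C} [Simple X]
    [Simple X'] {s : ℕ} (hs : s = 1 ∨ s = p - 1)
    (hX : (homDim k (𝟙_ C) (tensorPow X p) : k) ≠ 0)
    (hX' : (homDim k (𝟙_ C) (tensorPow X' p) : k) ≠ 0)
    (h : QuotientRetract ((cyclicPower C p).obj X) (box k C p (𝟙_ C) (jordanRep k p s)))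
    (h' : QuotientRetract ((cyclicPower C p).obj X') (box k C p (𝟙_ C) (jordanRep k p s))) :
    Nonempty (X ≅ X') := by
  have hp := (Fact.out : p.Prime).two_le
  have hunit : Simple (𝟙_ C) := IsFusion.simple_unit k
  have hs0 : s ≠ 0 := by omega
  have hsp : s ≤ p := by omega
  obtain ⟨a, b, hab⟩ := h
  obtain ⟨a', b', hab'⟩ := h'
  obtain ⟨f, hf, hf1, -⟩ := eigenvalue_of_quotientRetract hs0 hsp hX a b hab
  obtain ⟨f', hf', hf1', -⟩ := eigenvalue_of_quotientRetract hs0 hsp hX' a' b' hab'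
  refine nonempty_iso_of_not_negligible hinj (φ := a ≫ b') fun hneg => ?_
  have h1 := ((hneg.precomp b).postcomp a').tr_eq_zero k (𝟙 (𝟭 C))
  have h2 : (b ≫ a ≫ b') ≫ a' = boxMap (𝟙_ C) (f ≫ f') := by
    rw [boxMap_comp, ← hf, ← hf']
    simp
  rw [h2, tr_box_jordan hs0 hsp, jordanEigenvalue_comp, hf1, hf1', mul_one, mul_one,
    show tr k ((𝟙 (𝟭 C) : 𝟭 C ⟶ 𝟭 C).app (𝟙_ C)) = 1 from sdim_unit k, mul_one] at h1
  have h3 := cast_sq_eq_one (k := k) hs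
  rw [h1] at h3
  simp at h3

theorem nonempty_tensorPow_iso_unit {X : C} (e : X ≅ 𝟙_ C) (n : ℕ) :
    Nonempty (tensorPow X n ≅ 𝟙_ C) := by
  induction n with
  | zero => exact ⟨Iso.refl _⟩
  | succ n ih =>
    obtain ⟨e'⟩ := ih
    exact ⟨(e ⊗ᵢ e') ≪≫ λ_ _⟩

/-- A Frobenius injective symmetric fusion category whose Frobenius functor takes values in
`C ⊠ sVec` is non-degenerate. -/
theorem isNonDegenerate_of_frobenius_sVec (hp : 2 < p) (hinj : IsFrobeniusInjective C p)
    (hsVec : ∀ X : C, boxSubcategory k C p (sVec k p) ((frobenius C p).obj X)) :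
    IsNonDegenerate C := by
  classical
  intro hdeg
  have hunit : Simple (𝟙_ C) := IsFusion.simple_unit k
  have := finite_irr k C
  have := Fintype.ofFinite (Irr C)
  have hsum := sum_sdim_tensorPow_mul_homDim_eq_zero (k := k) p hdeg
  have hret : ∀ i : Irr C, (homDim k (𝟙_ C) (tensorPow i.obj p) : k) ≠ 0 →
      ∃ s, (s = 1 ∨ s = p - 1) ∧ QuotientRetract ((cyclicPower C p).obj i.obj)
        (box k C p (𝟙_ C) (jordanRep k p s)) := by
    intro i hi
    obtain ⟨Y, hY, s, hs, h⟩ := exists_quotientRetract_box hinj i.obj (hsVec i.obj)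
    exact ⟨s, hs, quotientRetract_box_unit hs h hi⟩
  set T : Finset (Irr C) :=
    Finset.univ.filter fun i => (homDim k (𝟙_ C) (tensorPow i.obj p) : k) ≠ 0 with hT
  -- Terms indexed by `T` equal `1` and the others vanish, so the vanishing sum is the cardinality
  -- of `T` in `k`.
  have hcard : (T.card : k) = 0 := by
    have hTne : ∀ i : Irr C, sdim k (tensorPow i.obj p) *
        (homDim k (𝟙_ C) (tensorPow i.obj p) : k) =
        if (homDim k (𝟙_ C) (tensorPow i.obj p) : k) ≠ 0 then 1 else 0 := by
      intro i
      split_ifs with hi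
      · obtain ⟨s, hs, h⟩ := hret i hi
        exact sdim_mul_homDim_of_quotientRetract hs hi h
      · rw [not_not.1 hi, mul_zero]
    rw [← hsum, Finset.sum_congr rfl fun i _ => hTne i, ← Finset.sum_filter, hT]
    simp
  -- The unit object belongs to `T`.
  have hpos : 0 < T.card := by
    obtain ⟨i, ⟨e⟩⟩ := exists_irr_iso (C := C) (𝟙_ C)
    obtain ⟨e'⟩ := nonempty_tensorPow_iso_unit e p
    refine Finset.card_pos.2 ⟨i, Finset.mem_filter.2 ⟨Finset.mem_univ _, ?_⟩⟩
    rw [homDim_congr_right e', homDim_simple, if_pos ⟨Iso.refl _⟩, Nat.cast_one]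
    exact one_ne_zero
  have hle : T.card ≤ 2 := by
    -- The block size `s` is injective on `T`, with values in `{1, p - 1}`.
    choose! s hs hr using hret
    calc T.card ≤ ({1, p - 1} : Finset ℕ).card := by
          refine Finset.card_le_card_of_injOn s (fun i hi => ?_) fun i hi j hj hij => ?_
          · have := hs i (Finset.mem_filter.1 hi).2
            simpa using this
          · have hi' := (Finset.mem_filter.1 hi).2
            have hj' := (Finset.mem_filter.1 hj).2
            obtain ⟨e⟩ := nonempty_iso_of_quotientRetract hinj (hs i hi') hi' hj' (hr i hi')
              (hij ▸ hr j hj')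
            exact irr_eq_of_iso e
      _ ≤ 2 := Finset.card_le_two
  -- A positive multiple of `p` cannot be at most `2`, since `2 < p`.
  have := Nat.le_of_dvd hpos ((CharP.cast_eq_zero_iff k p _).1 hcard)
  omega

end Main

end

end SymFus


theorem corollary4p2 {k : Type w} [Field k] [IsAlgClosed k] (p : ℕ) [Fact p.Prime] [CharP k p]
    (hp : 2 < p)
    (C : Type u) [Category.{v} C] [Abelian C] [Linear k C]
    [MonoidalCategory C] [MonoidalPreadditive C] [MonoidalLinear k C]
    [SymmetricCategory C] [RigidCategory C] [SymFus.IsFusion k C]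
    (hinj : SymFus.IsFrobeniusInjective C p)
    (htype : SymFus.HasFrobeniusType k C p (SymFus.sVec k p)) :
    SymFus.IsNonDegenerate C :=
  SymFus.isNonDegenerate_of_frobenius_sVec hp hinj htype.1.2
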